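/- **Setting.** Fix a path-loss exponent $\alpha>0$ and an SINR threshold $\beta>0$. An instance consists of $n\ge 2$ links $\ell_v=(s_v,r_v)$ (sender $s_v$, receiver $r_v\neq s_v$) in a metric space $(X,d)$, $k\ge 1$ channels, an ambient noise level $\nu\ge 0$, and valuations $b_{v,T}\in\mathbb N$ for all links $v$ and all $T\subseteq[k]$. Write $d_v=d(s_v,r_v)$. An allocation $S$ assigns to each link $v$ a bundle $S(v)\subseteq[k]$ and has social welfare $b(S)=\sum_v b_{v,S(v)}$. A set $M$ of links satisfies the SINR constraints at powers $p>0$ if $$\frac{p_i}{d(s_i,r_i)^\alpha}\ \ge\ \beta\Big(\sum_{j\in M\setminus\{i\}}\frac{p_j}{d(s_j,r_i)^\alpha}+\nu\Big)\qquad\text{for all } i\in M .$$ An allocation is feasible (with power control) if for every channel $j$ the set $\{v: j\in S(v)\}$ satisfies the SINR constraints at some positive powers, which may depend on $j$. **Weights.** Let $\pi$ be an ordering of the links by decreasing length $d_v$ (ties broken arbitrarily). For a parameter $\tau>0$ let $$w(u,v)=\frac1\tau\min\Big\{1,\frac{d_u^\alpha}{d(s_u,r_v)^\alpha}\Big\}+\frac1\tau\min\Big\{1,\frac{d_u^\alpha}{d(s_v,r_u)^\alpha}\Big\}\quad\text{if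 }\pi(v)<\pi(u)$$ (so $u$ is the shorter link), $w(u,v)=0$ otherwise, and $\bar w(u,v)=w(u,v)+w(v,u)$. A ratio with denominator $0$ counts as $\infty$. **Algorithm**, with parameters $\tau,\rho>0$. 1. Take an optimal solution $x$ of the LP that maximizes $\sum_{v,T}b_{v,T}x_{v,T}$ subject to $\sum_{u:\pi(u)<\pi(v)}\sum_{T\ni j}\bar w(u,v)x_{u,T}\le\rho$ for all $v,j$, and $\sum_T x_{v,T}\le 1$, $x_{v,T}\ge 0$ for all $v,T$. 2. Split $x=x^{(1)}+x^{(2)}$, where $x^{(1)}$ is the part of $x$ on bundles of size at most $\sqrt k$. For $l=1,2$, independently for all $v$, set $S^{(l)}(v):=T$ with probability $x^{(l)}_{v,T}/(4\sqrt k\rho)$ for each $T\ne\emptyset$, and $S^{(l)}(v):=\emptyset$ with the remaining probability. Then, for the links $v$ in the order $\pi$, set $S^{(l)}(v):=\emptyset$ if $\sum\bar w(u,v)\ge\frac12$, where the sum is over all $u$ with $\pi(u)<\pi(v)$ and $S^{(l)}(u)\cap S^{(l)}(v)\neq\emptyset$. Let $S$ be the better of $S^{(1)},S^{(2)}$. 3.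 Let $V'$ be the set of all links. While $V'\ne\emptyset$, for $i=1,2,\dots$: let $S_i(v)=S(v)$ for $v\in V'$ and $S_i(v)=\emptyset$ otherwise; consider the links $v\in V'$ in order of decreasing $\pi$; if $\sum_{u:S_i(u)\cap S_i(v)\ne\emptyset}\bar w(u,v)<1$, then delete $v$ from $V'$ (and keep $S_i(v)$), otherwise set $S_i(v):=\emptyset$. Return the $S_i$ of largest welfare. 4. Power control: on each channel, consider the set $M$ of links assigned to it from long to short and set $$p_v=2\beta\, d_v^\alpha\Big(\nu'+\sum_{u\in M,\ \pi(u)<\pi(v)}\frac{p_u}{d(s_u,r_v)^\alpha}\Big),$$ with $\nu'=\nu$ if $\nu>0$ and $\nu'=1$ if $\nu=0$. For real $C,\delta$, say that $X$ has $(C,\delta)$-packing if every ball of radius $R$ contains at most $C(R/t)^\delta$ points of mutual distance at least $t$, for all $0<t\le R$. The metric is *fading* if this holds for some $C$ and some $\delta<\alpha$, i.e. if its doubling dimension is less than $\alpha$. **Theorem.** There is $\tau>0$, depending only on $\alpha,\beta$, such that the following hold. * *Fading metrics.* For all $C$ and all $\delta<\alpha$ there are $\rho>0$ and $K>0$, depending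 only on $\alpha,\beta,C,\delta$, such that on every instance in a metric space with $(C,\delta)$-packing the algorithm with parameters $\tau,\rho$ is a $K\sqrt k\,\log n$-approximation. * *General metrics.* There are $c>0$ and $K>0$, depending only on $\alpha,\beta$, such that on every instance in any metric space the algorithm with parameters $\tau$ and $\rho=c\log n$ is a $K\sqrt k\,\log^2 n$-approximation. Here "a $q$-approximation" means: the LP has an optimal solution and, whichever one is used, the numbers in step 2 are probabilities; for every outcome of the random choices, on every channel the links assigned to it by the returned allocation satisfy the SINR constraints at the powers computed in step 4; and $b(S^*)\le q\cdot\mathbb E[b(\text{returned allocation})]$ for every feasible allocation $S^*$. -/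

import Mathlib

namespace SpectrumAuction

noncomputable section

/-! ### Allocations and the physical model

There are `n` links, indexed by `Fin n`; link `v` has sender `s v` and receiver `r v` in a metric
space `X`. There are `k` channels, indexed by `Fin k`. -/

/-- An allocation gives every link a bundle of channels. -/
abbrev Alloc (n k : ℕ) : Type := Fin n → Finset (Fin k)

/-- Social welfare of an allocation. -/
def welfare {n k : ℕ} (b : Fin n → Finset (Fin k) → ℕ) (S : Alloc n k) : ℕ :=
  ∑ v, b v (S v)

/-- The links that are assigned channel `j`. -/
def channelSet {n k : ℕ} (S : Alloc n k) (j : Fin k) : Finset (Fin n) :=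
  Finset.univ.filter fun v => j ∈ S v

/-- The links in `M`, transmitting at (positive) powers `p` at the same time on the same channel,
all satisfy the SINR constraint with path-loss exponent `α`, threshold `β` and noise `ν`.
A foreign sender located at the receiver would cause infinite interference; since Lean has
`x / 0 = 0`, this case is excluded explicitly. -/
def SINR {X : Type*} [MetricSpace X] {n : ℕ} (α β ν : ℝ) (s r : Fin n → X)
    (M : Finset (Fin n)) (p : Fin n → ℝ) : Prop :=
  ∀ i ∈ M, 0 < p i ∧ (∀ j ∈ M.erase i, s j ≠ r i) ∧
    β * (∑ j ∈ M.erase i, p j / dist (s j) (r i) ^ α + ν) ≤ p i / dist (s i) (r i) ^ α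

/-- Feasibility with power control: on every channel the assigned links satisfy the SINR
constraints for some choice of powers (powers may differ between channels). -/
def PowerFeasible {X : Type*} [MetricSpace X] {n k : ℕ} (α β ν : ℝ) (s r : Fin n → X)
    (S : Alloc n k) : Prop :=
  ∀ j, ∃ p : Fin n → ℝ, SINR α β ν s r (channelSet S j) p

/-- `X` has the packing property with constant `C` and exponent `δ`: a ball of radius `R` contains
at most `C (R / t) ^ δ` points of mutual distance at least `t`. The doubling dimension of `X` is the
infimum of the exponents `δ` that admit some `C`, and `X` is a fading metric for the path-loss
exponent `α` if its doubling dimension is smaller than `α`, i.e. if some `δ < α` and some `C` have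
this property. -/
def HasPacking (X : Type*) [MetricSpace X] (C δ : ℝ) : Prop :=
  ∀ (x : X) (R t : ℝ), 0 < t → t ≤ R → ∀ P : Finset X,
    (∀ y ∈ P, dist y x ≤ R) → (∀ y ∈ P, ∀ z ∈ P, y ≠ z → t ≤ dist y z) →
      (P.card : ℝ) ≤ C * (R / t) ^ δ

/-! ### Edge weights -/

/-- `min {1, a ^ α / b ^ α}` for `a > 0`, `b ≥ 0`, where the quotient is infinite if `b = 0`. -/
def cappedRatio (α a b : ℝ) : ℝ :=
  if b = 0 then 1 else min 1 (a ^ α / b ^ α)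

/-- The edge weight `w(u, v)`. The ordering `π` is by decreasing length, so `π v < π u` means that
`u` is the shorter of the two links; its length is the numerator in both ratios. -/
def weight {X : Type*} [MetricSpace X] {n : ℕ} (α τ : ℝ) (s r : Fin n → X)
    (π : Fin n ≃ Fin n) (u v : Fin n) : ℝ :=
  if π v < π u then
    1 / τ * cappedRatio α (dist (s u) (r u)) (dist (s u) (r v)) +
      1 / τ * cappedRatio α (dist (s u) (r u)) (dist (s v) (r u))
  else 0

/-- Symmetrization `w(u, v) + w(v, u)` of edge weights. -/
def symmWeight {n : ℕ} (w : Fin n → Fin n → ℝ) (u v : Fin n) : ℝ :=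
  w u v + w v u

/-! ### The linear program -/

/-- The constraints of the LP relaxation with parameter `ρ`, for symmetric weights `wb`. -/
def LPFeasible {n k : ℕ} (π : Fin n ≃ Fin n) (wb : Fin n → Fin n → ℝ) (ρ : ℝ)
    (x : Fin n → Finset (Fin k) → ℝ) : Prop :=
  (∀ v j, ∑ u ∈ Finset.univ.filter (fun u => π u < π v),
      ∑ T ∈ Finset.univ.filter (fun T : Finset (Fin k) => j ∈ T), wb u v * x u T ≤ ρ) ∧
  (∀ v, ∑ T, x v T ≤ 1) ∧
  (∀ v T, 0 ≤ x v T)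

/-- The objective of the LP. -/
def lpValue {n k : ℕ} (b : Fin n → Finset (Fin k) → ℕ) (x : Fin n → Finset (Fin k) → ℝ) : ℝ :=
  ∑ v, ∑ T, (b v T : ℝ) * x v T

/-- `x` is an optimal solution of the LP. -/
def LPOptimal {n k : ℕ} (π : Fin n ≃ Fin n) (wb : Fin n → Fin n → ℝ) (ρ : ℝ)
    (b : Fin n → Finset (Fin k) → ℕ) (x : Fin n → Finset (Fin k) → ℝ) : Prop :=
  LPFeasible π wb ρ x ∧ ∀ y, LPFeasible π wb ρ y → lpValue b y ≤ lpValue b x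

/-! ### Randomized rounding -/

/-- The part of the LP solution supported on bundles of size at most `√k`. -/
def smallPart {n k : ℕ} (x : Fin n → Finset (Fin k) → ℝ) : Fin n → Finset (Fin k) → ℝ :=
  fun v T => if (T.card : ℝ) ≤ Real.sqrt k then x v T else 0

/-- The remaining part of the LP solution. -/
def largePart {n k : ℕ} (x : Fin n → Finset (Fin k) → ℝ) : Fin n → Finset (Fin k) → ℝ :=
  fun v T => x v T - smallPart x v T

/-- Probability with which link `v` tentatively receives the bundle `T`: for `T ≠ ∅` it is
`x v T / (4 √k ρ)`, and the empty bundle takes the remaining probability. -/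
def roundProb {n k : ℕ} (ρ : ℝ) (x : Fin n → Finset (Fin k) → ℝ) (v : Fin n)
    (T : Finset (Fin k)) : ℝ :=
  if T = ∅ then
    1 - ∑ T' ∈ Finset.univ.erase (∅ : Finset (Fin k)), x v T' / (4 * Real.sqrt k * ρ)
  else x v T / (4 * Real.sqrt k * ρ)

/-- Probability of the tentative allocation `S`; the links are rounded independently. -/
def roundingProb {n k : ℕ} (ρ : ℝ) (x : Fin n → Finset (Fin k) → ℝ) (S : Alloc n k) : ℝ :=
  ∏ v, roundProb ρ x v (S v)

/-- Partial conflict resolution, considering the links in the order `π`: a link is removed if the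
total weight to earlier links that share a channel with it is at least `1 / 2`. -/
def partialResolve {n k : ℕ} (π : Fin n ≃ Fin n) (wb : Fin n → Fin n → ℝ) (S₀ : Alloc n k) :
    Alloc n k :=
  ((List.finRange n).map π.symm).foldl
    (fun S v =>
      if 1 / 2 ≤ ∑ u ∈ Finset.univ.filter (fun u => π u < π v ∧ (S v ∩ S u).Nonempty), wb u v
      then Function.update S v ∅ else S)
    S₀

/-- The better of two allocations. -/
def better {n k : ℕ} (b : Fin n → Finset (Fin k) → ℕ) (S₁ S₂ : Alloc n k) : Alloc n k :=
  if welfare b S₂ ≤ welfare b S₁ then S₁ else S₂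

/-! ### Making a partly feasible allocation feasible -/

/-- One round: start with the bundles of the links in `V'`, and consider these links in the order of
decreasing `π`. A link whose total weight to the links that currently share a channel with it is
less than `1` stays and is deleted from `V'`; any other link is removed from the allocation.
The result is the candidate allocation together with the set of links not deleted from `V'`. -/
def resolveRound {n k : ℕ} (π : Fin n ≃ Fin n) (wb : Fin n → Fin n → ℝ) (S : Alloc n k)
    (V' : Finset (Fin n)) : Alloc n k × Finset (Fin n) :=
  (((List.finRange n).reverse.map π.symm).filter (fun v => v ∈ V')).foldl
    (fun st v =>
      if ∑ u ∈ Finset.univ.filter (fun u => (st.1 v ∩ st.1 u).Nonempty), wb u v < 1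
      then (st.1, st.2.erase v)
      else (Function.update st.1 v ∅, st.2))
    ((fun v => if v ∈ V' then S v else ∅), V')

/-- The candidate allocations of the successive rounds, until `V'` is empty. The first argument
bounds the number of rounds; on a partly feasible allocation each round deletes at least one link
from `V'`, so a bound of `n` is never exceeded. -/
def candidates {n k : ℕ} (π : Fin n ≃ Fin n) (wb : Fin n → Fin n → ℝ) (S : Alloc n k) :
    ℕ → Finset (Fin n) → List (Alloc n k)
  | 0, _ => []
  | m + 1, V' =>
    if V' = ∅ then []
    else (resolveRound π wb S V').1 :: candidates π wb S m (resolveRound π wb S V').2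

/-- The best candidate allocation (the default is only used if there are no links). -/
def makeFeasible {n k : ℕ} (π : Fin n ≃ Fin n) (wb : Fin n → Fin n → ℝ)
    (b : Fin n → Finset (Fin k) → ℕ) (S : Alloc n k) : Alloc n k :=
  ((candidates π wb S n Finset.univ).argmax (welfare b)).getD S

/-- The allocation returned by the algorithm if the two rounding stages (for the small and for the
large bundles) produced the tentative allocations `S₁` and `S₂`. -/
def output {n k : ℕ} (π : Fin n ≃ Fin n) (wb : Fin n → Fin n → ℝ)
    (b : Fin n → Finset (Fin k) → ℕ) (S₁ S₂ : Alloc n k) : Alloc n k :=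
  makeFeasible π wb b (better b (partialResolve π wb S₁) (partialResolve π wb S₂))

/-- Expected welfare of the returned allocation, when the LP solution `x` is rounded. -/
def expectedWelfare {n k : ℕ} (π : Fin n ≃ Fin n) (wb : Fin n → Fin n → ℝ) (ρ : ℝ)
    (b : Fin n → Finset (Fin k) → ℕ) (x : Fin n → Finset (Fin k) → ℝ) : ℝ :=
  ∑ S₁ : Alloc n k, ∑ S₂ : Alloc n k,
    roundingProb ρ (smallPart x) S₁ * roundingProb ρ (largePart x) S₂ *
      (welfare b (output π wb b S₁ S₂) : ℝ)

/-! ### Power control -/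

/-- The power control procedure on a set `M` of links that share a channel. The links are considered
from long to short, and each one is given `2` times the power needed against the noise and the
interference of the longer links in `M`. (If there is no noise, powers can be scaled arbitrarily, and
the scale is fixed by calculating with noise level `1`.) -/
def powerControl {X : Type*} [MetricSpace X] {n : ℕ} (α β ν : ℝ) (s r : Fin n → X)
    (π : Fin n ≃ Fin n) (M : Finset (Fin n)) (v : Fin n) : ℝ :=
  2 * β * dist (s v) (r v) ^ α *
    ((∑ u ∈ (M.filter fun u => π u < π v).attach,
        powerControl α β ν s r π M u.1 / dist (s u.1) (r v) ^ α) +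
      if ν = 0 then 1 else ν)
termination_by π v
decreasing_by exact (Finset.mem_filter.mp u.2).2

theorem powerControl_eq {X : Type*} [MetricSpace X] {n : ℕ} (α β ν : ℝ) (s r : Fin n → X)
    (π : Fin n ≃ Fin n) (M : Finset (Fin n)) (v : Fin n) :
    powerControl α β ν s r π M v =
      2 * β * dist (s v) (r v) ^ α *
        ((∑ u ∈ M.filter fun u => π u < π v,
            powerControl α β ν s r π M u / dist (s u) (r v) ^ α) +
          if ν = 0 then 1 else ν) := by
  rw [powerControl, ← Finset.sum_attach (M.filter fun u => π u < π v)]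

/-! ### The performance guarantee -/

/-- LP rounding with parameter `ρ` and weights with parameter `τ`, in combination with power
control, works with approximation factor `ratio` on the given instance: the LP has an optimal
solution, and for each optimal solution
* the rounding stages draw from actual probability distributions,
* whatever they draw, the links sharing a channel in the returned allocation satisfy the SINR
  constraints at the powers computed by power control,
* the expected welfare is at least a `1 / ratio` fraction of the welfare of every allocation
  that is feasible for some choice of powers. -/
def Achieves {X : Type*} [MetricSpace X] {n k : ℕ} (α β ν τ ρ : ℝ) (s r : Fin n → X)
    (π : Fin n ≃ Fin n) (b : Fin n → Finset (Fin k) → ℕ) (ratio : ℝ) : Prop :=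
  (∃ x, LPOptimal π (symmWeight (weight α τ s r π)) ρ b x) ∧
  ∀ x, LPOptimal π (symmWeight (weight α τ s r π)) ρ b x →
    (∀ v T, 0 ≤ roundProb ρ (smallPart x) v T ∧ 0 ≤ roundProb ρ (largePart x) v T) ∧
    (∀ (S₁ S₂ : Alloc n k) (j : Fin k),
      SINR α β ν s r (channelSet (output π (symmWeight (weight α τ s r π)) b S₁ S₂) j)
        (powerControl α β ν s r π
          (channelSet (output π (symmWeight (weight α τ s r π)) b S₁ S₂) j))) ∧
    ∀ S : Alloc n k, PowerFeasible α β ν s r S →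
      (welfare b S : ℝ) ≤
        ratio * expectedWelfare π (symmWeight (weight α τ s r π)) ρ b x

end

end SpectrumAuction

/-!
A set `M` of links that share a channel is safe as soon as every link in it has total weight less
than `1`: such links are pairwise well separated, and a power proportional to the noise and the
interference of the longer links then leaves enough room for the interference of the shorter ones.
The algorithm only ever returns such sets.

For the welfare, the key is inductive independence: if `M` is feasible for some powers, then the
total weight between any link and the longer links in `M` is bounded. Summing over dyadic distance
scales, the contributions of the scales decay geometrically in fading metrics, and in general each
of `O(log n)` scales contributes a bounded amount. So feasible allocations are feasible for the
linear program.

Rounding with probabilities scaled down by `4 √k ρ` keeps the expected conflict of a link at most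
`1 / 4`: a small bundle has at most `√k` channels on which it can meet others, and a large bundle
fills at least `√k` of the `k` channels. By Markov's inequality each link survives partial
resolution with probability at least `1 / 2`. Finally, in each resolution round at least half of the
remaining links are settled, so one of the `O(log n)` candidates keeps the required share.
-/

namespace SpectrumAuction

/-! ### Capped ratios and edge weights -/

theorem cappedRatio_nonneg {α a b : ℝ} (ha : 0 ≤ a) (hb : 0 ≤ b) : 0 ≤ cappedRatio α a b := by
  unfold cappedRatio
  split_ifs <;> positivity

theorem cappedRatio_le_one (α a b : ℝ) : cappedRatio α a b ≤ 1 := by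
  unfold cappedRatio
  split_ifs
  exacts [le_rfl, min_le_left _ _]

theorem ne_zero_of_cappedRatio_lt_one {α a b : ℝ} (h : cappedRatio α a b < 1) : b ≠ 0 := by
  rintro rfl
  simp [cappedRatio] at h

theorem cappedRatio_eq_div_of_lt_one {α a b : ℝ} (h : cappedRatio α a b < 1) :
    cappedRatio α a b = a ^ α / b ^ α := by
  have hb := ne_zero_of_cappedRatio_lt_one h
  rw [cappedRatio, if_neg hb] at h ⊢
  exact min_eq_right ((min_lt_iff.mp h).resolve_left (lt_irrefl 1)).le

theorem lt_of_cappedRatio_lt_one {α a b : ℝ} (hα : 0 < α) (hb : 0 ≤ b)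
    (h : cappedRatio α a b < 1) : a < b := by
  have hb' : 0 < b := hb.lt_of_ne' (ne_zero_of_cappedRatio_lt_one h)
  by_contra! hab
  rw [cappedRatio_eq_div_of_lt_one h, div_lt_one (by positivity)] at h
  exact h.not_ge (Real.rpow_le_rpow hb hab hα.le)

theorem cappedRatio_le_inv_rpow {α a b c : ℝ} (hα : 0 < α) (ha : 0 < a) (hc : 0 < c)
    (h : c * a ≤ b) : cappedRatio α a b ≤ (c ^ α)⁻¹ := by
  have hb : 0 < b := (mul_pos hc ha).trans_le h
  rw [cappedRatio, if_neg hb.ne']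
  refine (min_le_right _ _).trans ?_
  rw [div_le_iff₀ (by positivity), ← div_eq_inv_mul, le_div_iff₀ (by positivity), mul_comm,
    ← Real.mul_rpow hc.le ha.le]
  gcongr

theorem symmWeight_nonneg {n : ℕ} {w : Fin n → Fin n → ℝ} (hw : ∀ u v, 0 ≤ w u v) (u v : Fin n) :
    0 ≤ symmWeight w u v := add_nonneg (hw u v) (hw v u)

theorem symmWeight_comm {n : ℕ} (w : Fin n → Fin n → ℝ) (u v : Fin n) :
    symmWeight w u v = symmWeight w v u := add_comm _ _

section Links

variable {X : Type*} [MetricSpace X] {n : ℕ} {α β ν τ : ℝ} {s r : Fin n → X} {π : Fin n ≃ Fin n}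

theorem weight_nonneg (hτ : 0 < τ) (u v : Fin n) : 0 ≤ weight α τ s r π u v := by
  have h (a b c d : X) : 0 ≤ cappedRatio α (dist a b) (dist c d) :=
    cappedRatio_nonneg dist_nonneg dist_nonneg
  unfold weight
  split_ifs
  · exact add_nonneg (mul_nonneg (by positivity) (h ..)) (mul_nonneg (by positivity) (h ..))
  · exact le_rfl

theorem symmWeight_weight_self (α τ : ℝ) (s r : Fin n → X) (π : Fin n ≃ Fin n) (v : Fin n) :
    symmWeight (weight α τ s r π) v v = 0 := by
  simp [symmWeight, weight]

theorem symmWeight_weight_of_lt {u v : Fin n} (h : π v < π u) :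
    symmWeight (weight α τ s r π) u v =
      1 / τ * (cappedRatio α (dist (s u) (r u)) (dist (s u) (r v)) +
        cappedRatio α (dist (s u) (r u)) (dist (s v) (r u))) := by
  rw [symmWeight, weight, weight, if_pos h, if_neg h.not_gt]
  ring

/-! ### Power control -/

/-- The geometric content of the weights on a set `M` of links: senders and receivers are apart from
one another, no link is closer to the receiver of a longer link than to its own receiver, and
against each link of `M` the shorter links of `M` have a total path-loss ratio of at most `τ`, in
either direction. -/
structure WellSeparated (α τ : ℝ) (s r : Fin n → X) (π : Fin n ≃ Fin n) (M : Finset (Fin n)) :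
    Prop where
  sender_ne_receiver : ∀ u ∈ M, ∀ v ∈ M, s u ≠ r v
  length_le_dist : ∀ u ∈ M, ∀ v ∈ M, π v < π u → dist (s u) (r u) ≤ dist (s u) (r v)
  sum_div_dist_sender_le : ∀ v ∈ M,
    ∑ u ∈ M with π v < π u, dist (s u) (r u) ^ α / dist (s u) (r v) ^ α ≤ τ
  sum_div_dist_receiver_le : ∀ v ∈ M,
    ∑ u ∈ M with π v < π u, dist (s u) (r u) ^ α / dist (s v) (r u) ^ α ≤ τ

theorem sum_cappedRatio_lt_of_sum_symmWeight_lt_one (hτ : 0 < τ) {M : Finset (Fin n)} {v : Fin n}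
    (hM : ∑ u ∈ M, symmWeight (weight α τ s r π) u v < 1) :
    ∑ u ∈ M with π v < π u, (cappedRatio α (dist (s u) (r u)) (dist (s u) (r v)) +
      cappedRatio α (dist (s u) (r u)) (dist (s v) (r u))) < τ := by
  suffices h : 1 / τ * ∑ u ∈ M with π v < π u,
      (cappedRatio α (dist (s u) (r u)) (dist (s u) (r v)) +
        cappedRatio α (dist (s u) (r u)) (dist (s v) (r u))) < 1 by
    rwa [one_div, inv_mul_lt_iff₀ hτ, mul_one] at h
  calc _ = ∑ u ∈ M with π v < π u, symmWeight (weight α τ s r π) u v := by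
        rw [Finset.mul_sum]
        exact Finset.sum_congr rfl fun u hu =>
          (symmWeight_weight_of_lt (Finset.mem_filter.mp hu).2).symm
    _ ≤ ∑ u ∈ M, symmWeight (weight α τ s r π) u v :=
        Finset.sum_le_sum_of_subset_of_nonneg (Finset.filter_subset _ _)
          fun u _ _ => symmWeight_nonneg (weight_nonneg hτ) u v
    _ < 1 := hM

theorem wellSeparated_of_sum_symmWeight_lt_one (hα : 0 < α) (hτ : 0 < τ) (hτ₁ : τ ≤ 1)
    (hsr : ∀ v, s v ≠ r v) {M : Finset (Fin n)}
    (hM : ∀ v ∈ M, ∑ u ∈ M, symmWeight (weight α τ s r π) u v < 1) :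
    WellSeparated α τ s r π M := by
  have hsum v (hv : v ∈ M) := sum_cappedRatio_lt_of_sum_symmWeight_lt_one hτ (hM v hv)
  have h₁ u v : 0 ≤ cappedRatio α (dist (s u) (r u)) (dist (s u) (r v)) :=
    cappedRatio_nonneg dist_nonneg dist_nonneg
  have h₂ u v : 0 ≤ cappedRatio α (dist (s u) (r u)) (dist (s v) (r u)) :=
    cappedRatio_nonneg dist_nonneg dist_nonneg
  have hlt : ∀ v ∈ M, ∀ u ∈ M, π v < π u →
      cappedRatio α (dist (s u) (r u)) (dist (s u) (r v)) +
        cappedRatio α (dist (s u) (r u)) (dist (s v) (r u)) < 1 := fun v hv u hu huv =>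
    ((Finset.single_le_sum (fun w _ => add_nonneg (h₁ w v) (h₂ w v))
      (Finset.mem_filter.mpr ⟨hu, huv⟩)).trans_lt (hsum v hv)).trans_le hτ₁
  have hlt₁ v (hv : v ∈ M) u (hu : u ∈ M) (huv : π v < π u) :
      cappedRatio α (dist (s u) (r u)) (dist (s u) (r v)) < 1 := by
    linarith [hlt v hv u hu huv, h₂ u v]
  have hlt₂ v (hv : v ∈ M) u (hu : u ∈ M) (huv : π v < π u) :
      cappedRatio α (dist (s u) (r u)) (dist (s v) (r u)) < 1 := by
    linarith [hlt v hv u hu huv, h₁ u v]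
  refine ⟨fun u hu v hv => ?_, fun u hu v hv huv => ?_, fun v hv => ?_, fun v hv => ?_⟩
  · rcases lt_trichotomy (π u) (π v) with h | h | h
    · exact dist_ne_zero.mp (ne_zero_of_cappedRatio_lt_one (hlt₂ u hu v hv h))
    · exact π.injective h ▸ hsr u
    · exact dist_ne_zero.mp (ne_zero_of_cappedRatio_lt_one (hlt₁ v hv u hu h))
  · exact (lt_of_cappedRatio_lt_one hα dist_nonneg (hlt₁ v hv u hu huv)).le
  · refine (Finset.sum_le_sum fun u hu => ?_).trans (hsum v hv).le
    obtain ⟨hu, huv⟩ := Finset.mem_filter.mp hu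
    rw [← cappedRatio_eq_div_of_lt_one (hlt₁ v hv u hu huv)]
    exact le_add_of_nonneg_right (h₂ u v)
  · refine (Finset.sum_le_sum fun u hu => ?_).trans (hsum v hv).le
    obtain ⟨hu, huv⟩ := Finset.mem_filter.mp hu
    rw [← cappedRatio_eq_div_of_lt_one (hlt₂ v hv u hu huv)]
    exact le_add_of_nonneg_left (h₁ u v)

/-- The interference that the senders of the links in `A`, transmitting at powers `p`, cause at the
receiver of `v`. -/
noncomputable def interference (α : ℝ) (s r : Fin n → X) (p : Fin n → ℝ) (A : Finset (Fin n))
    (v : Fin n) : ℝ :=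
  ∑ u ∈ A, p u / dist (s u) (r v) ^ α

/-- The noise level that power control calculates with. -/
noncomputable def noiseScale (ν : ℝ) : ℝ := if ν = 0 then 1 else ν

theorem noiseScale_pos (hν : 0 ≤ ν) : 0 < noiseScale ν := by
  unfold noiseScale
  split_ifs with h
  exacts [one_pos, hν.lt_of_ne' h]

theorem le_noiseScale (ν : ℝ) : ν ≤ noiseScale ν := by
  unfold noiseScale
  split_ifs with h
  exacts [h ▸ zero_le_one, le_rfl]

theorem interference_nonneg {p : Fin n → ℝ} {A : Finset (Fin n)} (hp : ∀ u ∈ A, 0 ≤ p u)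
    (v : Fin n) : 0 ≤ interference α s r p A v :=
  Finset.sum_nonneg fun u hu => div_nonneg (hp u hu) (by positivity)

theorem interference_erase_eq_add (α : ℝ) (s r : Fin n → X) (π : Fin n ≃ Fin n) (p : Fin n → ℝ)
    (M : Finset (Fin n)) (v : Fin n) :
    interference α s r p (M.erase v) v =
      interference α s r p {u ∈ M | π u < π v} v + interference α s r p {u ∈ M | π v < π u} v := by
  have hdisj : Disjoint {u ∈ M | π u < π v} {u ∈ M | π v < π u} :=
    Finset.disjoint_filter.mpr fun u _ h => h.not_gt
  rw [interference, interference, interference, ← Finset.sum_union hdisj, ← Finset.filter_or]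
  congr 1
  ext u
  simp only [Finset.mem_erase, Finset.mem_filter, lt_or_lt_iff_ne, π.injective.ne_iff]
  exact and_comm

theorem powerControl_eq_interference (α β ν : ℝ) (s r : Fin n → X) (π : Fin n ≃ Fin n)
    (M : Finset (Fin n)) (v : Fin n) :
    powerControl α β ν s r π M v = 2 * β * dist (s v) (r v) ^ α *
      (interference α s r (powerControl α β ν s r π M) {u ∈ M | π u < π v} v + noiseScale ν) :=
  powerControl_eq α β ν s r π M v

theorem powerControl_pos (hβ : 0 < β) (hν : 0 ≤ ν) (hsr : ∀ v, s v ≠ r v) (π : Fin n ≃ Fin n)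
    (M : Finset (Fin n)) (v : Fin n) : 0 < powerControl α β ν s r π M v := by
  induction hm : π v using WellFoundedLT.induction generalizing v with
  | ind m ih =>
    have hlength : 0 < dist (s v) (r v) := dist_pos.mpr (hsr v)
    have hlonger : 0 ≤ interference α s r (powerControl α β ν s r π M) {u ∈ M | π u < π v} v :=
      interference_nonneg
        (fun u hu => (ih (π u) (hm ▸ (Finset.mem_filter.mp hu).2) u rfl).le) v
    have hnoise := noiseScale_pos hν
    rw [powerControl_eq_interference]
    positivity

/-- The larger of `B` and `E` is at least `D / 3`. -/
theorem rpow_div_rpow_mul_inv_rpow_le {α A B D E : ℝ} (hα : 0 < α) (hA : 0 ≤ A) (hAB : A ≤ B)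
    (hB : 0 < B) (hD : 0 < D) (hE : 0 < E) (h : D ≤ E + A + B) :
    A ^ α / B ^ α * (E ^ α)⁻¹ ≤ 3 ^ α * (D ^ α)⁻¹ * (A ^ α / B ^ α + A ^ α / E ^ α) := by
  have hinv {F : ℝ} (hF : 0 < F) (hDF : D ≤ 3 * F) : (F ^ α)⁻¹ ≤ 3 ^ α * (D ^ α)⁻¹ := by
    rw [← div_eq_mul_inv, le_div_iff₀ (by positivity), inv_mul_le_iff₀ (by positivity), mul_comm,
      ← Real.mul_rpow (by norm_num) hF.le]
    gcongr
  rcases le_total B E with hBE | hEB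
  · calc A ^ α / B ^ α * (E ^ α)⁻¹ ≤ A ^ α / B ^ α * (3 ^ α * (D ^ α)⁻¹) := by
          gcongr
          exact hinv hE (by linarith)
      _ = 3 ^ α * (D ^ α)⁻¹ * (A ^ α / B ^ α + 0) := by ring
      _ ≤ _ := by gcongr; positivity
  · calc A ^ α / B ^ α * (E ^ α)⁻¹ = A ^ α / E ^ α * (B ^ α)⁻¹ := by ring
      _ ≤ A ^ α / E ^ α * (3 ^ α * (D ^ α)⁻¹) := by
          gcongr
          exact hinv hB (by linarith)
      _ = 3 ^ α * (D ^ α)⁻¹ * (0 + A ^ α / E ^ α) := by ring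
      _ ≤ _ := by gcongr; positivity

theorem sum_sum_mul_add_le {ι κ : Type*} [Preorder κ] [DecidableLT κ] {M : Finset ι} {π : ι → κ}
    {g a : ι → ℝ} {c : ι → ι → ℝ} {v : ι} {τ : ℝ} (hg : ∀ x ∈ M, 0 ≤ g x) (ha : ∀ u ∈ M, 0 ≤ a u)
    (hc : ∀ u ∈ M, ∀ x ∈ M, 0 ≤ c u x) (haτ : ∑ u ∈ M with π v < π u, a u ≤ τ)
    (hcτ : ∀ x ∈ M, ∑ u ∈ M with π x < π u, c u x ≤ τ) :
    ∑ u ∈ M with π v < π u, ∑ x ∈ M with π x < π u, g x * (a u + c u x) ≤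
      2 * τ * ∑ x ∈ M, g x := by
  have ha_sum : ∑ u ∈ M with π v < π u, ∑ x ∈ M with π x < π u, g x * a u ≤ τ * ∑ x ∈ M, g x :=
    calc _ ≤ ∑ u ∈ M with π v < π u, ∑ x ∈ M, g x * a u :=
          Finset.sum_le_sum fun u hu => Finset.sum_le_sum_of_subset_of_nonneg
            (Finset.filter_subset _ _) fun x hx _ =>
              mul_nonneg (hg x hx) (ha u (Finset.mem_of_mem_filter u hu))
      _ = (∑ u ∈ M with π v < π u, a u) * ∑ x ∈ M, g x := by
          simp_rw [Finset.sum_mul_sum, mul_comm]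
      _ ≤ τ * ∑ x ∈ M, g x := by gcongr; exact Finset.sum_nonneg hg
  have hc_sum : ∑ u ∈ M with π v < π u, ∑ x ∈ M with π x < π u, g x * c u x ≤ τ * ∑ x ∈ M, g x :=
    calc _ ≤ ∑ u ∈ M, ∑ x ∈ M with π x < π u, g x * c u x :=
          Finset.sum_le_sum_of_subset_of_nonneg (Finset.filter_subset _ _) fun u hu _ =>
            Finset.sum_nonneg fun x hx =>
              have hx := Finset.mem_of_mem_filter x hx
              mul_nonneg (hg x hx) (hc u hu x hx)
      _ = ∑ x ∈ M, g x * ∑ u ∈ M with π x < π u, c u x := by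
          simp_rw [Finset.mul_sum]
          exact Finset.sum_comm' fun u x => by simp only [Finset.mem_filter]; tauto
      _ ≤ ∑ x ∈ M, g x * τ := by
          gcongr with x hx
          exacts [hg x hx, hcτ x hx]
      _ = τ * ∑ x ∈ M, g x := by rw [← Finset.sum_mul, mul_comm]
  simp only [mul_add, Finset.sum_add_distrib]
  linarith

theorem WellSeparated.relayed_interference_le {M : Finset (Fin n)} (hM : WellSeparated α τ s r π M)
    (hα : 0 < α) {u v x : Fin n} (hu : u ∈ M) (hv : v ∈ M) (hx : x ∈ M) (huv : π v < π u) :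
    dist (s u) (r u) ^ α / dist (s u) (r v) ^ α * (dist (s x) (r u) ^ α)⁻¹ ≤
      3 ^ α * (dist (s x) (r v) ^ α)⁻¹ *
        (dist (s u) (r u) ^ α / dist (s u) (r v) ^ α +
          dist (s u) (r u) ^ α / dist (s x) (r u) ^ α) := by
  refine rpow_div_rpow_mul_inv_rpow_le hα dist_nonneg (hM.length_le_dist u hu v hv huv)
    (dist_pos.mpr (hM.sender_ne_receiver u hu v hv))
    (dist_pos.mpr (hM.sender_ne_receiver x hx v hv))
    (dist_pos.mpr (hM.sender_ne_receiver x hx u hu)) ?_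
  simpa only [dist_comm (r u) (s u)] using dist_triangle4 (s x) (r u) (s u) (r v)

theorem WellSeparated.interference_shorter_le {M : Finset (Fin n)} (hM : WellSeparated α τ s r π M)
    (hα : 0 < α) {γ N : ℝ} (hγ : 0 ≤ γ) (hN : 0 ≤ N) {p : Fin n → ℝ} (hp : ∀ u ∈ M, 0 ≤ p u)
    (hpM : ∀ u ∈ M, p u = γ * dist (s u) (r u) ^ α *
      (interference α s r p {x ∈ M | π x < π u} u + N)) {v : Fin n} (hv : v ∈ M) :
    interference α s r p {u ∈ M | π v < π u} v ≤
      γ * τ * (N + 2 * 3 ^ α * interference α s r p M v) := by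
  let a u := dist (s u) (r u) ^ α / dist (s u) (r v) ^ α
  let c u x := dist (s u) (r u) ^ α / dist (s x) (r u) ^ α
  have hterm : ∀ u ∈ M, π v < π u → p u / dist (s u) (r v) ^ α ≤ γ * (N * a u +
      ∑ x ∈ M with π x < π u, 3 ^ α * (p x / dist (s x) (r v) ^ α) * (a u + c u x)) := by
    intro u hu huv
    calc p u / dist (s u) (r v) ^ α =
        γ * (N * a u + ∑ x ∈ M with π x < π u, p x * (a u * (dist (s x) (r u) ^ α)⁻¹)) := by
          rw [hpM u hu, interference, add_comm, mul_assoc, mul_div_assoc, mul_add, add_div,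
            Finset.mul_sum, Finset.sum_div]
          congr 2
          · ring
          · exact Finset.sum_congr rfl fun x _ => by ring
      _ ≤ _ := by
          refine mul_le_mul_of_nonneg_left
            (add_le_add_right (Finset.sum_le_sum fun x hx => ?_) _) hγ
          refine (mul_le_mul_of_nonneg_left (hM.relayed_interference_le hα hu hv
            (Finset.mem_filter.mp hx).1 huv) (hp x (Finset.mem_filter.mp hx).1)).trans_eq ?_
          ring
  calc interference α s r p {u ∈ M | π v < π u} v ≤
      ∑ u ∈ M with π v < π u, γ * (N * a u +
        ∑ x ∈ M with π x < π u, 3 ^ α * (p x / dist (s x) (r v) ^ α) * (a u + c u x)) :=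
        Finset.sum_le_sum fun u hu =>
          hterm u (Finset.mem_filter.mp hu).1 (Finset.mem_filter.mp hu).2
    _ = γ * (N * ∑ u ∈ M with π v < π u, a u + ∑ u ∈ M with π v < π u,
        ∑ x ∈ M with π x < π u, 3 ^ α * (p x / dist (s x) (r v) ^ α) * (a u + c u x)) := by
        rw [← Finset.mul_sum, Finset.sum_add_distrib, ← Finset.mul_sum]
    _ ≤ γ * (N * τ + 2 * τ * ∑ x ∈ M, 3 ^ α * (p x / dist (s x) (r v) ^ α)) := by
        gcongr
        · exact hM.sum_div_dist_sender_le v hv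
        · exact sum_sum_mul_add_le
            (fun x hx => mul_nonneg (by positivity) (div_nonneg (hp x hx) (by positivity)))
            (fun u _ => by positivity) (fun u _ x _ => by positivity)
            (hM.sum_div_dist_sender_le v hv) hM.sum_div_dist_receiver_le
    _ = _ := by
        rw [interference, ← Finset.mul_sum]
        ring

theorem le_add_of_le_mul_add {β τ L H N t : ℝ} (hβ : 0 < β) (hτ : 0 ≤ τ) (hL : 0 ≤ L) (hH : 0 ≤ H)
    (hN : 0 ≤ N) (ht : 1 ≤ t) (hτβ : 8 * β * t * (1 + 2 * β) * τ ≤ 1)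
    (h : H ≤ 2 * β * τ * (N + 2 * t * (L + H + 2 * β * (L + N)))) : H ≤ L + N := by
  have hN' : 0 ≤ 2 * β * τ * N := by positivity
  have hNt := mul_le_mul_of_nonneg_left ht hN'
  have hβt : 4 * β * t * τ ≤ 1 / 2 := by nlinarith [show 0 ≤ 4 * β * t * τ * (2 * β) by positivity]
  have hH' := mul_le_mul_of_nonneg_right hβt hH
  have hLN := mul_le_mul_of_nonneg_right hτβ (add_nonneg hL hN)
  linarith

theorem WellSeparated.sinr_powerControl {M : Finset (Fin n)} (hM : WellSeparated α τ s r π M)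
    (hα : 0 < α) (hβ : 0 < β) (hτ : 0 ≤ τ) (hτβ : 8 * β * 3 ^ α * (1 + 2 * β) * τ ≤ 1)
    (hν : 0 ≤ ν) (hsr : ∀ v, s v ≠ r v) :
    SINR α β ν s r M (powerControl α β ν s r π M) := by
  intro v hv
  set p := powerControl α β ν s r π M
  set N := noiseScale ν
  have hp u : 0 < p u := powerControl_pos hβ hν hsr π M u
  have hN : 0 < N := noiseScale_pos hν
  set L := interference α s r p {u ∈ M | π u < π v} v
  set H := interference α s r p {u ∈ M | π v < π u} v
  have hL : 0 ≤ L := interference_nonneg (fun u _ => (hp u).le) v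
  have hH : 0 ≤ H := interference_nonneg (fun u _ => (hp u).le) v
  have hsignal : p v / dist (s v) (r v) ^ α = 2 * β * (L + N) := by
    have := dist_pos.mpr (hsr v)
    rw [show p v = 2 * β * dist (s v) (r v) ^ α * (L + N) from
      powerControl_eq_interference α β ν s r π M v]
    field_simp
  have herase : interference α s r p (M.erase v) v = L + H :=
    interference_erase_eq_add α s r π p M v
  have htotal : interference α s r p M v = L + H + 2 * β * (L + N) := by
    rw [← herase, ← hsignal]
    exact (Finset.sum_erase_add M _ hv).symm
  have hshorter : H ≤ 2 * β * τ * (N + 2 * 3 ^ α * (L + H + 2 * β * (L + N))) :=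
    htotal ▸ hM.interference_shorter_le hα (by positivity) hN.le (fun u _ => (hp u).le)
      (fun u _ => powerControl_eq_interference α β ν s r π M u) hv
  have hHL : H ≤ L + N := le_add_of_le_mul_add hβ hτ hL hH hN.le
    (Real.one_le_rpow (by norm_num) hα.le) hτβ hshorter
  refine ⟨hp v, fun u hu => hM.sender_ne_receiver u (Finset.mem_of_mem_erase hu) v hv, ?_⟩
  calc β * (interference α s r p (M.erase v) v + ν) ≤ β * (L + (L + N) + N) := by
        rw [herase]
        gcongr
        exact le_noiseScale ν
    _ = p v / dist (s v) (r v) ^ α := by rw [hsignal]; ring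

end Links


/-! ### Feasible sets of links near a point -/

theorem card_le_of_mul_sum_erase_le {ι : Type*} [DecidableEq ι] {Q : Finset ι} {q : ι → ℝ} {γ : ℝ}
    (hγ : 0 < γ) (hq : ∀ i ∈ Q, 0 < q i) (h : ∀ i ∈ Q, γ * ∑ j ∈ Q.erase i, q j ≤ q i) :
    (Q.card : ℝ) ≤ 1 + 1 / γ := by
  rcases Q.eq_empty_or_nonempty with rfl | hne
  · rw [Finset.card_empty, Nat.cast_zero]
    positivity
  have hpos : 0 < ∑ i ∈ Q, q i := Finset.sum_pos hq hne
  have hsum : γ * (Q.card - 1) * ∑ i ∈ Q, q i ≤ ∑ i ∈ Q, q i :=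
    calc _ = ∑ i ∈ Q, γ * (∑ j ∈ Q, q j - q i) := by
          rw [← Finset.mul_sum, Finset.sum_sub_distrib, Finset.sum_const, nsmul_eq_mul]
          ring
      _ ≤ ∑ i ∈ Q, q i := Finset.sum_le_sum fun i hi => by
          rw [← Finset.sum_erase_add Q q hi, add_sub_cancel_right]
          exact h i hi
  rw [← sub_le_iff_le_add', le_div_iff₀' hγ]
  exact (mul_le_iff_le_one_left hpos).mp hsum

section Links

variable {X : Type*} [MetricSpace X] {n : ℕ} {α β ν : ℝ} {s r : Fin n → X} {M : Finset (Fin n)}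
  {p : Fin n → ℝ}

theorem SINR.mono (hβ : 0 ≤ β) {Q : Finset (Fin n)} (h : SINR α β ν s r M p) (hQ : Q ⊆ M) :
    SINR α β ν s r Q p := by
  intro i hi
  obtain ⟨hpos, hne, hsinr⟩ := h i (hQ hi)
  refine ⟨hpos, fun j hj => hne j (Finset.erase_subset_erase i hQ hj), le_trans ?_ hsinr⟩
  gcongr
  intro j hj _
  have := (h j (Finset.mem_of_mem_erase hj)).1
  positivity

theorem SINR.mul_sum_le (hβ : 0 ≤ β) (hν : 0 ≤ ν) (h : SINR α β ν s r M p) {i : Fin n}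
    (hi : i ∈ M) :
    β * ∑ j ∈ M.erase i, p j / dist (s j) (r i) ^ α ≤ p i / dist (s i) (r i) ^ α :=
  le_trans (by gcongr; exact le_add_of_nonneg_right hν) (h i hi).2.2

theorem SINR.card_le_of_dist_le_mul_receiver_length (hα : 0 ≤ α) (hβ : 0 < β) (hν : 0 ≤ ν)
    (h : SINR α β ν s r M p) (hsr : ∀ i ∈ M, s i ≠ r i) {κ : ℝ} (hκ : 0 < κ)
    (hdist : ∀ i ∈ M, ∀ j ∈ M, dist (s j) (r i) ≤ κ * dist (s i) (r i)) :
    (M.card : ℝ) ≤ 1 + κ ^ α / β := by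
  rw [← one_div_div]
  refine card_le_of_mul_sum_erase_le (q := p) (by positivity) (fun i hi => (h i hi).1) ?_
  intro i hi
  have hlength : 0 < dist (s i) (r i) := dist_pos.mpr (hsr i hi)
  have hinterference : (∑ j ∈ M.erase i, p j) / (κ * dist (s i) (r i)) ^ α ≤
      ∑ j ∈ M.erase i, p j / dist (s j) (r i) ^ α := by
    rw [Finset.sum_div]
    gcongr with j hj
    · exact (h j (Finset.mem_of_mem_erase hj)).1.le
    · have : 0 < dist (s j) (r i) := dist_pos.mpr ((h i hi).2.1 j hj)
      positivity
    · exact hdist i hi j (Finset.mem_of_mem_erase hj)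
  have hsinr := (mul_le_mul_of_nonneg_left hinterference hβ.le).trans (h.mul_sum_le hβ.le hν hi)
  rw [Real.mul_rpow hκ.le hlength.le, ← div_div, mul_div_assoc',
    div_le_div_iff_of_pos_right (by positivity)] at hsinr
  rwa [div_mul_eq_mul_div, mul_div_assoc]

theorem SINR.card_le_of_dist_le_mul_sender_length (hα : 0 ≤ α) (hβ : 0 < β) (hν : 0 ≤ ν)
    (h : SINR α β ν s r M p) (hsr : ∀ i ∈ M, s i ≠ r i) {κ : ℝ} (hκ : 0 < κ)
    (hdist : ∀ i ∈ M, ∀ j ∈ M, dist (s j) (r i) ≤ κ * dist (s j) (r j)) :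
    (M.card : ℝ) ≤ 1 + κ ^ α / β := by
  have hlength i (hi : i ∈ M) : 0 < dist (s i) (r i) := dist_pos.mpr (hsr i hi)
  rw [← one_div_div]
  refine card_le_of_mul_sum_erase_le (q := fun i => p i / dist (s i) (r i) ^ α) (by positivity)
    (fun i hi => div_pos (h i hi).1 (Real.rpow_pos_of_pos (hlength i hi) α)) fun i hi => ?_
  refine le_trans ?_ (h.mul_sum_le hβ.le hν hi)
  rw [div_mul_eq_mul_div, mul_div_assoc, Finset.sum_div]
  refine mul_le_mul_of_nonneg_left (Finset.sum_le_sum fun j hj => ?_) hβ.le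
  have hjM := Finset.mem_of_mem_erase hj
  have hpos : 0 < dist (s j) (r i) := dist_pos.mpr ((h i hi).2.1 j hj)
  have hpj := (h j hjM).1
  rw [div_div, ← Real.mul_rpow (hlength j hjM).le hκ.le, mul_comm]
  gcongr
  exact hdist i hi j hjM

theorem SINR.card_senders_near_le (hα : 0 ≤ α) (hβ : 0 < β) (hν : 0 ≤ ν) (h : SINR α β ν s r M p)
    {t R : ℝ} (ht : 0 < t) (hM : ∀ u ∈ M, t ≤ dist (s u) (r u)) (hR : t ≤ R) (y : X) :
    ({u ∈ M | dist (s u) y ≤ R}.card : ℝ) ≤ 1 + 3 ^ α / β * (R / t) ^ α := by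
  have hRt : 0 < R / t := div_pos (ht.trans_le hR) ht
  rw [div_mul_eq_mul_div, ← Real.mul_rpow (by norm_num) hRt.le]
  refine (h.mono hβ.le (Finset.filter_subset _ M)).card_le_of_dist_le_mul_receiver_length hα hβ hν
    (fun i hi => dist_pos.mp (ht.trans_le (hM i (Finset.mem_filter.mp hi).1))) (by positivity) ?_
  intro i hi j hj
  obtain ⟨hiM, hiy⟩ := Finset.mem_filter.mp hi
  obtain ⟨-, hjy⟩ := Finset.mem_filter.mp hj
  have hR_le : R ≤ R / t * dist (s i) (r i) := by
    rw [div_mul_comm]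
    exact le_mul_of_one_le_left (ht.le.trans hR) ((one_le_div ht).mpr (hM i hiM))
  have hlength_le : dist (s i) (r i) ≤ R / t * dist (s i) (r i) :=
    le_mul_of_one_le_left dist_nonneg ((one_le_div ht).mpr hR)
  linarith [dist_triangle4 (s j) y (s i) (r i), dist_comm y (s i)]

theorem SINR.card_receivers_near_le (hα : 0 ≤ α) (hβ : 0 < β) (hν : 0 ≤ ν)
    (h : SINR α β ν s r M p) {t R : ℝ} (ht : 0 < t) (hM : ∀ u ∈ M, t ≤ dist (s u) (r u))
    (hR : t ≤ R) (y : X) :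
    ({u ∈ M | dist (r u) y ≤ R}.card : ℝ) ≤ 1 + 3 ^ α / β * (R / t) ^ α := by
  have hRt : 0 < R / t := div_pos (ht.trans_le hR) ht
  rw [div_mul_eq_mul_div, ← Real.mul_rpow (by norm_num) hRt.le]
  refine (h.mono hβ.le (Finset.filter_subset _ M)).card_le_of_dist_le_mul_sender_length hα hβ hν
    (fun i hi => dist_pos.mp (ht.trans_le (hM i (Finset.mem_filter.mp hi).1))) (by positivity) ?_
  intro i hi j hj
  obtain ⟨-, hiy⟩ := Finset.mem_filter.mp hi
  obtain ⟨hjM, hjy⟩ := Finset.mem_filter.mp hj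
  have hR_le : R ≤ R / t * dist (s j) (r j) := by
    rw [div_mul_comm]
    exact le_mul_of_one_le_left (ht.le.trans hR) ((one_le_div ht).mpr (hM j hjM))
  have hlength_le : dist (s j) (r j) ≤ R / t * dist (s j) (r j) :=
    le_mul_of_one_le_left dist_nonneg ((one_le_div ht).mpr hR)
  linarith [dist_triangle4 (s j) (r j) y (r i), dist_comm y (r i)]

theorem exists_separated_subset_covering (A : Finset X) {t : ℝ} (ht : 0 ≤ t) :
    ∃ P ⊆ A, (∀ y ∈ P, ∀ z ∈ P, y ≠ z → t ≤ dist y z) ∧ ∀ x ∈ A, ∃ y ∈ P, dist x y ≤ t := by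
  lift t to NNReal using ht
  obtain ⟨N, hN⟩ := (A.finite_toSet.finite_subsets.subset fun N hN => hN.1).exists_maximal
    (s := {N : Set X | N ⊆ A ∧ Metric.IsSeparated t N}) ⟨∅, by simp⟩
  lift N to Finset X using A.finite_toSet.subset hN.prop.1
  refine ⟨N, mod_cast hN.prop.1, fun y hy z hz hyz => ?_, fun x hx => ?_⟩
  · have hlt : (t : ENNReal) < edist y z := hN.prop.2 hy hz hyz
    rw [edist_nndist] at hlt
    exact mod_cast hlt.le
  · obtain ⟨y, hy, hxy⟩ := Metric.IsCover.of_maximal_isSeparated hN hx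
    exact ⟨y, hy, edist_le_coe.mp hxy⟩

theorem HasPacking.nonneg {C δ : ℝ} (hX : HasPacking X C δ) (x : X) : 0 ≤ C := by
  simpa using hX x 1 1 one_pos le_rfl ∅ (by simp) (by simp)

theorem HasPacking.card_near_le {C δ : ℝ} (hX : HasPacking X C δ) {ι : Type*} (f : ι → X)
    (M : Finset ι) {t N R : ℝ} (ht : 0 < t) (hR : t ≤ R)
    (hN : ∀ y, ({u ∈ M | dist (f u) y ≤ t}.card : ℝ) ≤ N) (x : X) :
    ({u ∈ M | dist (f u) x ≤ R}.card : ℝ) ≤ C * (R / t) ^ δ * N := by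
  classical
  obtain ⟨P, hPsub, hPsep, hPcover⟩ :=
    exists_separated_subset_covering ({u ∈ M | dist (f u) x ≤ R}.image f) ht.le
  have hPcard : (P.card : ℝ) ≤ C * (R / t) ^ δ := by
    refine hX x R t ht hR P (fun y hy => ?_) hPsep
    obtain ⟨u, hu, rfl⟩ := Finset.mem_image.mp (hPsub hy)
    exact (Finset.mem_filter.mp hu).2
  have hcover : {u ∈ M | dist (f u) x ≤ R} ⊆ P.biUnion fun y => {u ∈ M | dist (f u) y ≤ t} := by
    intro u hu
    obtain ⟨y, hy, huy⟩ := hPcover (f u) (Finset.mem_image_of_mem f hu)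
    exact Finset.mem_biUnion.mpr ⟨y, hy, Finset.mem_filter.mpr ⟨(Finset.mem_filter.mp hu).1, huy⟩⟩
  calc ({u ∈ M | dist (f u) x ≤ R}.card : ℝ) ≤ ∑ y ∈ P, ({u ∈ M | dist (f u) y ≤ t}.card : ℝ) :=
        mod_cast (Finset.card_le_card hcover).trans Finset.card_biUnion_le
    _ ≤ ∑ _y ∈ P, N := Finset.sum_le_sum fun y _ => hN y
    _ = P.card * N := by rw [Finset.sum_const, nsmul_eq_mul]
    _ ≤ _ := mul_le_mul_of_nonneg_right hPcard ((Nat.cast_nonneg _).trans (hN x))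

end Links

/-! ### Dyadic summation -/

theorem cappedRatio_le_sum_dyadic {α t : ℝ} (hα : 0 < α) (ht : 0 < t) (x : ℝ) (L : ℕ) :
    cappedRatio α t x ≤
      2 ^ α * (∑ m ∈ Finset.range L, (if x ≤ 2 ^ m * t then ((2 ^ α) ^ m)⁻¹ else 0) +
        ((2 ^ α) ^ L)⁻¹) := by
  have h2 : (1 : ℝ) ≤ 2 ^ α := Real.one_le_rpow (by norm_num) hα.le
  induction L with
  | zero => simpa using (cappedRatio_le_one α t x).trans h2
  | succ L ih =>
    rw [Finset.sum_range_succ]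
    split_ifs with hx
    · refine ih.trans ?_
      gcongr 2 ^ α * ?_
      exact le_add_of_nonneg_right (by positivity)
    · calc cappedRatio α t x ≤ (((2 : ℝ) ^ L) ^ α)⁻¹ :=
            cappedRatio_le_inv_rpow hα ht (by positivity) (not_le.mp hx).le
        _ = 2 ^ α * ((2 ^ α) ^ (L + 1))⁻¹ := by
            rw [← Real.rpow_pow_comm (by norm_num), pow_succ]
            field_simp
        _ ≤ _ := by
            gcongr
            exact le_add_of_nonneg_left (add_nonneg
              (Finset.sum_nonneg fun m _ => by split_ifs <;> positivity) le_rfl)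

theorem sum_cappedRatio_le_sum_dyadic {ι : Type*} {α t : ℝ} (hα : 0 < α) (ht : 0 < t)
    {M : Finset ι} {x : ι → ℝ} {N : ℕ → ℝ} (hN : ∀ m, ({u ∈ M | x u ≤ 2 ^ m * t}.card : ℝ) ≤ N m)
    {L : ℕ} (hL : (M.card : ℝ) ≤ (2 ^ α) ^ L) :
    ∑ u ∈ M, cappedRatio α t (x u) ≤
      2 ^ α * (∑ m ∈ Finset.range L, N m * ((2 ^ α) ^ m)⁻¹ + 1) := by
  calc _ ≤ ∑ u ∈ M, 2 ^ α * (∑ m ∈ Finset.range L,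
        (if x u ≤ 2 ^ m * t then ((2 ^ α) ^ m)⁻¹ else 0) + ((2 ^ α) ^ L)⁻¹) :=
        Finset.sum_le_sum fun u _ => cappedRatio_le_sum_dyadic hα ht (x u) L
    _ = 2 ^ α * (∑ m ∈ Finset.range L, ({u ∈ M | x u ≤ 2 ^ m * t}.card : ℝ) * ((2 ^ α) ^ m)⁻¹ +
          M.card * ((2 ^ α) ^ L)⁻¹) := by
        rw [← Finset.mul_sum, Finset.sum_add_distrib, Finset.sum_comm]
        simp only [← Finset.sum_filter, Finset.sum_const, nsmul_eq_mul]
    _ ≤ _ := by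
        gcongr with m
        · exact hN m
        · rwa [← div_eq_mul_inv, div_le_one (by positivity)]

theorem exists_le_two_rpow_pow_of_two_le {α N : ℝ} (hα : 0 < α) (hN : 2 ≤ N) :
    ∃ L : ℕ, N ≤ (2 ^ α) ^ L ∧
      (L : ℝ) ≤ (1 / (α * Real.log 2) + 1 / Real.log 2) * Real.log N := by
  have hlog2 : 0 < Real.log 2 := Real.log_pos (by norm_num)
  have hlogN : Real.log 2 ≤ Real.log N := Real.log_le_log (by norm_num) hN
  refine ⟨⌈Real.log N / (α * Real.log 2)⌉₊, ?_, ?_⟩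
  · rw [← Real.log_le_log_iff (by linarith) (by positivity), Real.log_pow,
      Real.log_rpow (by norm_num), ← div_le_iff₀ (by positivity)]
    exact Nat.le_ceil _
  · calc (⌈Real.log N / (α * Real.log 2)⌉₊ : ℝ) ≤ Real.log N / (α * Real.log 2) + 1 :=
          (Nat.ceil_lt_add_one (div_nonneg (hlog2.le.trans hlogN) (by positivity))).le
      _ ≤ Real.log N / (α * Real.log 2) + Real.log N / Real.log 2 := by
          gcongr
          exact (one_le_div hlog2).mpr hlogN
      _ = _ := by ring

theorem sum_cappedRatio_le_mul_log {ι : Type*} {α A t N : ℝ} (hα : 0 < α) (ht : 0 < t)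
    (hA : 0 ≤ A) (hN : 2 ≤ N) {M : Finset ι} (hM : (M.card : ℝ) ≤ N) {x : ι → ℝ}
    (hcard : ∀ R, t ≤ R → ({u ∈ M | x u ≤ R}.card : ℝ) ≤ 1 + A * (R / t) ^ α) :
    ∑ u ∈ M, cappedRatio α t (x u) ≤ 2 ^ α * ((1 + A) * (1 / (α * Real.log 2) + 1 / Real.log 2) +
      1 / Real.log 2) * Real.log N := by
  obtain ⟨L, hNL, hL⟩ := exists_le_two_rpow_pow_of_two_le hα hN
  have hscale m : ({u ∈ M | x u ≤ 2 ^ m * t}.card : ℝ) ≤ 1 + A * (2 ^ α) ^ m := by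
    rw [Real.rpow_pow_comm (by norm_num)]
    simpa [ht.ne'] using
      hcard (2 ^ m * t) (le_mul_of_one_le_left ht.le (one_le_pow₀ (by norm_num)))
  have hterm m : (1 + A * (2 ^ α) ^ m) * ((2 ^ α) ^ m)⁻¹ ≤ 1 + A := by
    rw [add_mul, mul_assoc, mul_inv_cancel₀ (by positivity), one_mul, mul_one]
    gcongr
    exact inv_le_one_of_one_le₀ (one_le_pow₀ (Real.one_le_rpow (by norm_num) hα.le))
  calc ∑ u ∈ M, cappedRatio α t (x u) ≤
      2 ^ α * (∑ m ∈ Finset.range L, (1 + A * (2 ^ α) ^ m) * ((2 ^ α) ^ m)⁻¹ + 1) :=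
        sum_cappedRatio_le_sum_dyadic hα ht hscale (hM.trans hNL)
    _ ≤ 2 ^ α * (L * (1 + A) + 1) := by
        gcongr
        simpa only [Finset.card_range, nsmul_eq_mul] using
          Finset.sum_le_card_nsmul (Finset.range L) _ _ fun m _ => hterm m
    _ ≤ 2 ^ α * ((1 / (α * Real.log 2) + 1 / Real.log 2) * Real.log N * (1 + A) +
          Real.log N / Real.log 2) := by
        gcongr
        exact (one_le_div (Real.log_pos (by norm_num))).mpr (Real.log_le_log (by norm_num) hN)
    _ = _ := by ring

theorem sum_cappedRatio_le_of_card_le_rpow {ι : Type*} {α δ A t : ℝ} (hα : 0 < α) (hδ : δ < α)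
    (ht : 0 < t) (hA : 0 ≤ A) {M : Finset ι} {x : ι → ℝ}
    (hcard : ∀ R, t ≤ R → ({u ∈ M | x u ≤ R}.card : ℝ) ≤ A * (R / t) ^ δ) :
    ∑ u ∈ M, cappedRatio α t (x u) ≤ 2 ^ α * (A * (1 - 2 ^ (δ - α))⁻¹ + 1) := by
  obtain ⟨L, hL⟩ := pow_unbounded_of_one_lt (M.card : ℝ) (Real.one_lt_rpow one_lt_two hα)
  have hscale m : ({u ∈ M | x u ≤ 2 ^ m * t}.card : ℝ) ≤ A * (2 ^ δ) ^ m := by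
    rw [Real.rpow_pow_comm (by norm_num)]
    simpa [ht.ne'] using
      hcard (2 ^ m * t) (le_mul_of_one_le_left ht.le (one_le_pow₀ (by norm_num)))
  have hratio : (2 : ℝ) ^ (δ - α) < 1 :=
    Real.rpow_lt_one_of_one_lt_of_neg one_lt_two (sub_neg.mpr hδ)
  have hratio₀ : (0 : ℝ) ≤ 2 ^ (δ - α) := by positivity
  calc ∑ u ∈ M, cappedRatio α t (x u) ≤
      2 ^ α * (∑ m ∈ Finset.range L, A * (2 ^ δ) ^ m * ((2 ^ α) ^ m)⁻¹ + 1) :=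
        sum_cappedRatio_le_sum_dyadic hα ht hscale hL.le
    _ = 2 ^ α * (A * ∑ m ∈ Finset.range L, ((2 : ℝ) ^ (δ - α)) ^ m + 1) := by
        rw [Finset.mul_sum]
        congr! 3 with m
        rw [Real.rpow_sub two_pos, div_pow, mul_assoc, div_eq_mul_inv]
    _ ≤ _ := by
        gcongr
        rw [← tsum_geometric_of_lt_one hratio₀ hratio]
        exact (summable_geometric_of_lt_one hratio₀ hratio).sum_le_tsum _
          fun m _ => pow_nonneg hratio₀ m

/-! ### Inductive independence -/

/-- The inductive independence number of the weights `wb` with respect to the ordering `π` and the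
family `F` of feasible sets is at most `ρ`. -/
def InductiveIndependenceLE {n : ℕ} (π : Fin n ≃ Fin n) (wb : Fin n → Fin n → ℝ)
    (F : Finset (Fin n) → Prop) (ρ : ℝ) : Prop :=
  ∀ M v, F M → ∑ u ∈ M with π u < π v, wb u v ≤ ρ

/-- A bound on the inductive independence number in metric spaces with `(C, δ)`-packing. -/
noncomputable def fadingBound (α β τ C δ : ℝ) : ℝ :=
  2 * (2 ^ α * (C * (1 + 3 ^ α / β) * (1 - 2 ^ (δ - α))⁻¹ + 1)) / τ

/-- The constant in the logarithmic bound on the inductive independence number in general metric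
spaces. -/
noncomputable def generalBound (α β τ : ℝ) : ℝ :=
  2 * (2 ^ α * ((1 + 3 ^ α / β) * (1 / (α * Real.log 2) + 1 / Real.log 2) + 1 / Real.log 2)) / τ

theorem generalBound_nonneg {α β τ : ℝ} (hα : 0 ≤ α) (hβ : 0 ≤ β) (hτ : 0 ≤ τ) :
    0 ≤ generalBound α β τ := by
  have : 0 < Real.log 2 := Real.log_pos (by norm_num)
  unfold generalBound
  positivity

theorem InductiveIndependenceLE.mono {n : ℕ} {π : Fin n ≃ Fin n} {wb : Fin n → Fin n → ℝ}
    {F : Finset (Fin n) → Prop} {ρ ρ' : ℝ} (h : InductiveIndependenceLE π wb F ρ) (hρ : ρ ≤ ρ') :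
    InductiveIndependenceLE π wb F ρ' :=
  fun M v hM => (h M v hM).trans hρ

section Links

variable {X : Type*} [MetricSpace X] {n : ℕ} {α β ν τ B : ℝ} {s r : Fin n → X} {π : Fin n ≃ Fin n}

theorem sum_symmWeight_longer_le (hτ : 0 < τ) {M : Finset (Fin n)} {v : Fin n}
    (hM : ∀ u ∈ M, π u < π v)
    (hs : ∑ u ∈ M, cappedRatio α (dist (s v) (r v)) (dist (s u) (r v)) ≤ B)
    (hr : ∑ u ∈ M, cappedRatio α (dist (s v) (r v)) (dist (r u) (s v)) ≤ B) :
    ∑ u ∈ M, symmWeight (weight α τ s r π) u v ≤ 2 * B / τ := by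
  calc _ = 1 / τ * (∑ u ∈ M, cappedRatio α (dist (s v) (r v)) (dist (r u) (s v)) +
        ∑ u ∈ M, cappedRatio α (dist (s v) (r v)) (dist (s u) (r v))) := by
        rw [← Finset.sum_add_distrib, Finset.mul_sum]
        refine Finset.sum_congr rfl fun u hu => ?_
        rw [symmWeight_comm, symmWeight_weight_of_lt (hM u hu), dist_comm (s v) (r u)]
    _ ≤ 1 / τ * (B + B) := by gcongr
    _ = _ := by ring

theorem inductiveIndependenceLE_of_longer (hβ : 0 ≤ β) (hτ : 0 < τ)
    (hπ : ∀ u v, π u < π v → dist (s v) (r v) ≤ dist (s u) (r u))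
    (hB : ∀ M p v, SINR α β ν s r M p → (∀ u ∈ M, dist (s v) (r v) ≤ dist (s u) (r u)) →
      ∑ u ∈ M, cappedRatio α (dist (s v) (r v)) (dist (s u) (r v)) ≤ B ∧
      ∑ u ∈ M, cappedRatio α (dist (s v) (r v)) (dist (r u) (s v)) ≤ B) :
    InductiveIndependenceLE π (symmWeight (weight α τ s r π))
      (fun M => ∃ p, SINR α β ν s r M p) (2 * B / τ) := by
  rintro M v ⟨p, hp⟩
  have hlonger : ∀ u ∈ {u ∈ M | π u < π v}, π u < π v := fun u hu => (Finset.mem_filter.mp hu).2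
  obtain ⟨hs, hr⟩ := hB _ p v (hp.mono hβ (Finset.filter_subset (π · < π v) M))
    fun u hu => hπ u v (hlonger u hu)
  exact sum_symmWeight_longer_le hτ hlonger hs hr

theorem inductiveIndependenceLE_general (hα : 0 < α) (hβ : 0 < β) (hν : 0 ≤ ν) (hτ : 0 < τ)
    (hn : 2 ≤ n) (hsr : ∀ v, s v ≠ r v)
    (hπ : ∀ u v, π u < π v → dist (s v) (r v) ≤ dist (s u) (r u)) :
    InductiveIndependenceLE π (symmWeight (weight α τ s r π))
      (fun M => ∃ p, SINR α β ν s r M p) (generalBound α β τ * Real.log n) := by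
  have hn' : (2 : ℝ) ≤ n := mod_cast hn
  have hcard (M : Finset (Fin n)) : (M.card : ℝ) ≤ n := mod_cast card_finset_fin_le M
  rw [generalBound, div_mul_eq_mul_div, mul_assoc 2]
  refine inductiveIndependenceLE_of_longer hβ.le hτ hπ fun M p v h hlen => ?_
  have hv : 0 < dist (s v) (r v) := dist_pos.mpr (hsr v)
  exact ⟨sum_cappedRatio_le_mul_log hα hv (by positivity) hn' (hcard M) fun R hR =>
      h.card_senders_near_le hα.le hβ hν hv hlen hR (r v),
    sum_cappedRatio_le_mul_log hα hv (by positivity) hn' (hcard M) fun R hR =>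
      h.card_receivers_near_le hα.le hβ hν hv hlen hR (s v)⟩

theorem HasPacking.inductiveIndependenceLE {C δ : ℝ} (hX : HasPacking X C δ) (hα : 0 < α)
    (hδ : δ < α) (hβ : 0 < β) (hν : 0 ≤ ν) (hτ : 0 < τ) (hsr : ∀ v, s v ≠ r v)
    (hπ : ∀ u v, π u < π v → dist (s v) (r v) ≤ dist (s u) (r u)) :
    InductiveIndependenceLE π (symmWeight (weight α τ s r π))
      (fun M => ∃ p, SINR α β ν s r M p) (fadingBound α β τ C δ) := by
  refine inductiveIndependenceLE_of_longer hβ.le hτ hπ fun M p v h hlen => ?_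
  have hC : 0 ≤ C := hX.nonneg (s v)
  have hv : 0 < dist (s v) (r v) := dist_pos.mpr (hsr v)
  refine ⟨sum_cappedRatio_le_of_card_le_rpow hα hδ hv (by positivity) fun R hR => ?_,
    sum_cappedRatio_le_of_card_le_rpow hα hδ hv (by positivity) fun R hR => ?_⟩
  · rw [mul_right_comm]
    refine hX.card_near_le s M hv hR (fun y => ?_) (r v)
    simpa [hv.ne'] using h.card_senders_near_le hα.le hβ hν hv hlen le_rfl y
  · rw [mul_right_comm]
    refine hX.card_near_le r M hv hR (fun y => ?_) (s v)
    simpa [hv.ne'] using h.card_receivers_near_le hα.le hβ hν hv hlen le_rfl y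

end Links

/-! ### Conflict resolution -/

section Conflicts

variable {n k : ℕ} {π : Fin n ≃ Fin n} {wb : Fin n → Fin n → ℝ}

/-- The links preceding `v` in the order `π`. -/
abbrev earlier (π : Fin n ≃ Fin n) (v : Fin n) : Finset (Fin n) := {u | π u < π v}

/-- The links following `v` in the order `π`. -/
abbrev later (π : Fin n ≃ Fin n) (v : Fin n) : Finset (Fin n) := {u | π v < π u}

/-- The total weight between `v` and the links in `I` that have a channel of `T` under `S`, i.e.
the conflict that `v` would have with the links in `I` if it were given the bundle `T`. -/
def conflict (wb : Fin n → Fin n → ℝ) (I : Finset (Fin n)) (S : Alloc n k) (T : Finset (Fin k))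
    (v : Fin n) : ℝ :=
  ∑ u ∈ I with (T ∩ S u).Nonempty, wb u v

theorem conflict_mono (hwb : ∀ u v, 0 ≤ wb u v) {I : Finset (Fin n)} {S S' : Alloc n k}
    {T : Finset (Fin k)} {v : Fin n} (h : ∀ u ∈ I, S u ⊆ S' u) :
    conflict wb I S T v ≤ conflict wb I S' T v := by
  refine Finset.sum_le_sum_of_subset_of_nonneg (fun u hu => ?_) fun u _ _ => hwb u v
  rw [Finset.mem_filter] at hu ⊢
  exact ⟨hu.1, hu.2.mono (Finset.inter_subset_inter_left (h u hu.1))⟩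

theorem conflict_congr {I : Finset (Fin n)} {S S' : Alloc n k} {T : Finset (Fin k)} {v : Fin n}
    (h : ∀ u ∈ I, S u = S' u) : conflict wb I S T v = conflict wb I S' T v :=
  Finset.sum_congr (Finset.filter_congr fun u hu => by rw [h u hu]) fun _ _ => rfl

theorem conflict_empty (wb : Fin n → Fin n → ℝ) (I : Finset (Fin n)) (S : Alloc n k)
    (v : Fin n) : conflict wb I S ∅ v = 0 := by
  simp [conflict]

theorem conflict_univ (hself : ∀ v, wb v v = 0) (π : Fin n ≃ Fin n) (S : Alloc n k)
    (T : Finset (Fin k)) (v : Fin n) :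
    conflict wb Finset.univ S T v =
      conflict wb (earlier π v) S T v + conflict wb (later π v) S T v := by
  simp only [conflict, Finset.sum_filter]
  rw [← Finset.sum_add_distrib]
  refine Finset.sum_congr rfl fun u _ => ?_
  rcases lt_trichotomy (π u) (π v) with h | h | h
  · simp [h, h.not_gt]
  · simp [π.injective h, hself]
  · simp [h, h.not_gt]

/-- Partly feasible allocations: every link has conflict less than `1 / 2` with earlier links. -/
def PartlyFeasible (π : Fin n ≃ Fin n) (wb : Fin n → Fin n → ℝ) (S : Alloc n k) : Prop :=
  ∀ v, conflict wb (earlier π v) S (S v) v < 1 / 2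

/-- Treatment of one link `v` in a greedy conflict resolution: `v` keeps its bundle iff its conflict
with `I v` is below the threshold `θ`. Partial resolution uses the earlier links and `θ = 1 / 2`,
the rounds of full resolution use all links and `θ = 1`. -/
noncomputable def pruneStep (wb : Fin n → Fin n → ℝ) (I : Fin n → Finset (Fin n)) (θ : ℝ)
    (S : Alloc n k) (v : Fin n) : Alloc n k :=
  if conflict wb (I v) S (S v) v < θ then S else Function.update S v ∅

/-- Greedy conflict resolution along a list of links. -/
noncomputable def prune (wb : Fin n → Fin n → ℝ) (I : Fin n → Finset (Fin n)) (θ : ℝ)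
    (l : List (Fin n)) (S : Alloc n k) : Alloc n k :=
  l.foldl (pruneStep wb I θ) S

variable {I : Fin n → Finset (Fin n)} {θ : ℝ}

theorem pruneStep_of_ne (S : Alloc n k) {v w : Fin n} (h : w ≠ v) :
    pruneStep wb I θ S v w = S w := by
  unfold pruneStep
  split_ifs
  exacts [rfl, Function.update_of_ne h _ _]

theorem pruneStep_self_eq_or (S : Alloc n k) (v : Fin n) :
    pruneStep wb I θ S v v = S v ∨ pruneStep wb I θ S v v = ∅ := by
  unfold pruneStep
  split_ifs
  exacts [Or.inl rfl, Or.inr (Function.update_self ..)]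

theorem prune_eq_or (l : List (Fin n)) (S : Alloc n k) (v : Fin n) :
    prune wb I θ l S v = S v ∨ prune wb I θ l S v = ∅ := by
  induction l generalizing S with
  | nil => exact Or.inl rfl
  | cons w l ih =>
    have hstep : pruneStep wb I θ S w v = S v ∨ pruneStep wb I θ S w v = ∅ := by
      rcases eq_or_ne v w with rfl | h
      exacts [pruneStep_self_eq_or S v, Or.inl (pruneStep_of_ne S h)]
    rcases ih (pruneStep wb I θ S w) with h | h
    · exact hstep.imp h.trans h.trans
    · exact Or.inr h

theorem prune_subset (l : List (Fin n)) (S : Alloc n k) (v : Fin n) :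
    prune wb I θ l S v ⊆ S v := by
  rcases prune_eq_or l S v with h | h
  exacts [h.subset, h ▸ Finset.empty_subset _]

theorem pruneStep_subset (S : Alloc n k) (v w : Fin n) : pruneStep wb I θ S v w ⊆ S w :=
  prune_subset [v] S w

theorem prune_of_notMem {l : List (Fin n)} (S : Alloc n k) {v : Fin n} (hv : v ∉ l) :
    prune wb I θ l S v = S v := by
  induction l generalizing S with
  | nil => rfl
  | cons w l ih =>
    rw [List.mem_cons, not_or] at hv
    exact (ih _ hv.2).trans (pruneStep_of_ne S hv.1)

theorem conflict_prune_lt (hwb : ∀ u v, 0 ≤ wb u v) (hθ : 0 < θ) {l : List (Fin n)}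
    (S : Alloc n k) {v : Fin n} (hv : v ∈ l) :
    conflict wb (I v) (prune wb I θ l S) (prune wb I θ l S v) v < θ := by
  induction l generalizing S with
  | nil => exact absurd hv List.not_mem_nil
  | cons w l ih =>
    by_cases hvl : v ∈ l
    · exact ih _ hvl
    obtain rfl : v = w := (List.mem_cons.mp hv).resolve_right hvl
    change conflict wb (I v) (prune wb I θ l _) (prune wb I θ l (pruneStep wb I θ S v) v) v < θ
    rw [prune_of_notMem _ hvl]
    refine (conflict_mono hwb fun u _ => prune_subset l _ u).trans_lt ?_
    unfold pruneStep
    split_ifs with hc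
    · exact hc
    · rwa [Function.update_self, conflict_empty]

theorem prune_eq_self (hwb : ∀ u v, 0 ≤ wb u v) (l : List (Fin n)) {S : Alloc n k} {v : Fin n}
    (hv : conflict wb (I v) S (S v) v < θ) : prune wb I θ l S v = S v := by
  induction l generalizing S with
  | nil => rfl
  | cons w l ih =>
    change prune wb I θ l (pruneStep wb I θ S w) v = S v
    have hstep : pruneStep wb I θ S w v = S v := by
      rcases eq_or_ne v w with rfl | h
      exacts [by rw [pruneStep, if_pos hv], pruneStep_of_ne S h]
    rw [ih, hstep]
    rw [hstep]
    exact (conflict_mono hwb fun u _ => pruneStep_subset S w u).trans_lt hv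

/-- When the links are treated from the last to the first, a later link has already found its final
bundle at the time `v` is treated, and an earlier one still has its original bundle or none. -/
theorem le_conflict_of_prune_ne (hwb : ∀ u v, 0 ≤ wb u v) (hself : ∀ v, wb v v = 0)
    {l : List (Fin n)} (hl : l.Pairwise fun u v => π v < π u) {S : Alloc n k} {v : Fin n}
    (hv : prune wb (fun _ => Finset.univ) θ l S v ≠ S v) :
    θ ≤ conflict wb (earlier π v) S (S v) v +
      conflict wb (later π v) (prune wb (fun _ => Finset.univ) θ l S) (S v) v := by
  induction l generalizing S with
  | nil => exact absurd rfl hv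
  | cons w l ih =>
    rw [List.pairwise_cons] at hl
    set S' := pruneStep wb (fun _ => Finset.univ) θ S w with hS'
    change prune wb _ θ l S' v ≠ S v at hv
    change θ ≤ _ + conflict wb _ (prune wb _ θ l S') _ v
    rcases eq_or_ne v w with rfl | hvw
    · have hvl : v ∉ l := fun h => lt_irrefl _ (hl.1 v h)
      have hlater : ∀ u ∈ later π v, prune wb (fun _ => Finset.univ) θ l S' u = S u := by
        intro u hu
        have hvu : π v < π u := (Finset.mem_filter.mp hu).2
        rw [prune_of_notMem _ fun h => (hl.1 u h).not_gt hvu, hS',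
          pruneStep_of_ne S (ne_of_apply_ne π hvu.ne')]
      rw [conflict_congr hlater, ← conflict_univ hself]
      by_contra! hc
      rw [prune_of_notMem _ hvl, hS', pruneStep, if_pos hc] at hv
      exact hv rfl
    · have hSv : S' v = S v := pruneStep_of_ne S hvw
      rw [← hSv] at hv ⊢
      exact (ih hl.2 hv).trans
        (add_le_add (conflict_mono hwb fun u _ => pruneStep_subset S w u) le_rfl)

/-! ### Partial conflict resolution -/

theorem pairwise_map_symm_finRange (π : Fin n ≃ Fin n) :
    ((List.finRange n).map π.symm).Pairwise fun u v => π u < π v := by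
  rw [List.pairwise_map]
  simp only [Equiv.apply_symm_apply]
  exact (List.sortedLT_finRange n).pairwise

theorem mem_map_symm_finRange (π : Fin n ≃ Fin n) (v : Fin n) :
    v ∈ (List.finRange n).map π.symm :=
  List.mem_map.mpr ⟨π v, List.mem_finRange _, π.symm_apply_apply v⟩

theorem partialResolve_eq_prune (π : Fin n ≃ Fin n) (wb : Fin n → Fin n → ℝ) (S : Alloc n k) :
    partialResolve π wb S =
      prune wb (earlier π) (1 / 2) ((List.finRange n).map π.symm) S := by
  unfold partialResolve prune
  congr 1
  funext S v
  simp only [pruneStep, conflict, Finset.filter_filter, ← not_le, ite_not]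

theorem partlyFeasible_partialResolve (hwb : ∀ u v, 0 ≤ wb u v) (π : Fin n ≃ Fin n)
    (S : Alloc n k) : PartlyFeasible π wb (partialResolve π wb S) := fun v => by
  rw [partialResolve_eq_prune]
  exact conflict_prune_lt hwb one_half_pos S (mem_map_symm_finRange π v)

theorem partialResolve_eq_self (hwb : ∀ u v, 0 ≤ wb u v) {S : Alloc n k} {v : Fin n}
    (hv : conflict wb (earlier π v) S (S v) v < 1 / 2) : partialResolve π wb S v = S v := by
  rw [partialResolve_eq_prune]
  exact prune_eq_self hwb _ hv

/-! ### Rounds of full conflict resolution -/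

/-- The links of `V'` in the order in which a round considers them. -/
def roundOrder (π : Fin n ≃ Fin n) (V' : Finset (Fin n)) : List (Fin n) :=
  ((List.finRange n).reverse.map π.symm).filter fun v => v ∈ V'

theorem roundOrder_pairwise (π : Fin n ≃ Fin n) (V' : Finset (Fin n)) :
    (roundOrder π V').Pairwise fun u v => π v < π u := by
  refine List.Pairwise.filter _ ?_
  rw [List.map_reverse, List.pairwise_reverse]
  exact pairwise_map_symm_finRange π

theorem roundOrder_nodup (π : Fin n ≃ Fin n) (V' : Finset (Fin n)) : (roundOrder π V').Nodup :=
  (roundOrder_pairwise π V').imp fun h => ne_of_apply_ne π h.ne'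

theorem mem_roundOrder {V' : Finset (Fin n)} {v : Fin n} : v ∈ roundOrder π V' ↔ v ∈ V' := by
  simp only [roundOrder, List.mem_filter, List.map_reverse, List.mem_reverse, decide_eq_true_eq,
    mem_map_symm_finRange, true_and]

/-- The treatment of one link in a round, with the bookkeeping of the links that remain to be
handled expressed through `pruneStep`: a link is done iff it keeps its bundle. -/
noncomputable def roundStep (wb : Fin n → Fin n → ℝ) (st : Alloc n k × Finset (Fin n))
    (v : Fin n) : Alloc n k × Finset (Fin n) :=
  (pruneStep wb (fun _ => Finset.univ) 1 st.1 v,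
    if pruneStep wb (fun _ => Finset.univ) 1 st.1 v v = st.1 v then st.2.erase v else st.2)

theorem resolveRound_eq_foldl (π : Fin n ≃ Fin n) (wb : Fin n → Fin n → ℝ) (S : Alloc n k)
    (V' : Finset (Fin n)) :
    resolveRound π wb S V' =
      (roundOrder π V').foldl (roundStep wb) (fun v => if v ∈ V' then S v else ∅, V') := by
  unfold resolveRound roundOrder
  congr 1
  funext st v
  change (if conflict wb Finset.univ st.1 (st.1 v) v < 1 then _ else _) = _
  unfold roundStep pruneStep
  split_ifs with hc he he
  · rfl
  · exact absurd rfl he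
  · rw [Function.update_self] at he
    rw [← he, conflict_empty] at hc
    exact absurd one_pos hc
  · rfl

theorem foldl_roundStep_fst (wb : Fin n → Fin n → ℝ) (l : List (Fin n))
    (st : Alloc n k × Finset (Fin n)) :
    (l.foldl (roundStep wb) st).1 = prune wb (fun _ => Finset.univ) 1 l st.1 :=
  (List.foldl_hom Prod.fst fun _ _ => rfl).symm

theorem mem_foldl_roundStep_snd {l : List (Fin n)} (hl : l.Nodup)
    (st : Alloc n k × Finset (Fin n)) (v : Fin n) :
    v ∈ (l.foldl (roundStep wb) st).2 ↔
      v ∈ st.2 ∧ (v ∈ l → prune wb (fun _ => Finset.univ) 1 l st.1 v ≠ st.1 v) := by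
  induction l generalizing st with
  | nil => simp
  | cons w l ih =>
    rw [List.nodup_cons] at hl
    rw [List.foldl_cons, ih hl.2]
    change _ ↔ _ ∧ (_ → prune wb _ 1 l (roundStep wb st w).1 v ≠ _)
    rcases eq_or_ne v w with rfl | hvw
    · rw [prune_of_notMem _ hl.1]
      simp only [hl.1, false_imp_iff, and_true, List.mem_cons_self, true_imp_iff, roundStep]
      split_ifs with h <;> simp [h]
    · have hfst : (roundStep wb st w).1 v = st.1 v :=
        pruneStep_of_ne (I := fun _ => Finset.univ) (θ := 1) st.1 hvw
      have hsnd : v ∈ (roundStep wb st w).2 ↔ v ∈ st.2 := by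
        unfold roundStep
        split_ifs <;> simp [hvw]
      rw [hsnd, hfst, List.mem_cons, or_iff_right hvw]

theorem mem_resolveRound_snd {S : Alloc n k} {V' : Finset (Fin n)} {v : Fin n} :
    v ∈ (resolveRound π wb S V').2 ↔ v ∈ V' ∧ (resolveRound π wb S V').1 v ≠ S v := by
  rw [resolveRound_eq_foldl, mem_foldl_roundStep_snd (roundOrder_nodup π V'), mem_roundOrder,
    foldl_roundStep_fst]
  refine and_congr_right fun hv => ?_
  simp only [hv, if_true, true_imp_iff]

theorem resolveRound_snd_subset (π : Fin n ≃ Fin n) (wb : Fin n → Fin n → ℝ) (S : Alloc n k)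
    (V' : Finset (Fin n)) : (resolveRound π wb S V').2 ⊆ V' :=
  fun _ hv => (mem_resolveRound_snd.mp hv).1

theorem resolveRound_fst_apply (π : Fin n ≃ Fin n) (wb : Fin n → Fin n → ℝ) (S : Alloc n k)
    (V' : Finset (Fin n)) (v : Fin n) :
    (resolveRound π wb S V').1 v = if v ∈ V' \ (resolveRound π wb S V').2 then S v else ∅ := by
  have hor : (resolveRound π wb S V').1 v = (if v ∈ V' then S v else ∅) ∨
      (resolveRound π wb S V').1 v = ∅ := by
    rw [resolveRound_eq_foldl, foldl_roundStep_fst]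
    exact prune_eq_or _ _ v
  simp only [Finset.mem_sdiff, mem_resolveRound_snd]
  by_cases hv : v ∈ V'
  · by_cases h : (resolveRound π wb S V').1 v = S v
    · simp [hv, h]
    · simpa [hv, h] using hor
  · simpa [hv] using hor

theorem conflict_resolveRound_lt (hwb : ∀ u v, 0 ≤ wb u v) (π : Fin n ≃ Fin n) (S : Alloc n k)
    (V' : Finset (Fin n)) (v : Fin n) :
    conflict wb Finset.univ (resolveRound π wb S V').1 ((resolveRound π wb S V').1 v) v < 1 := by
  by_cases hv : v ∈ V'
  · rw [resolveRound_eq_foldl, foldl_roundStep_fst]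
    exact conflict_prune_lt (I := fun _ => Finset.univ) hwb one_pos _ (mem_roundOrder.mpr hv)
  · rw [resolveRound_fst_apply π wb S V' v, if_neg (by simp [hv]), conflict_empty]
    exact one_pos

theorem half_lt_conflict_later_resolveRound (hwb : ∀ u v, 0 ≤ wb u v) (hself : ∀ v, wb v v = 0)
    {S : Alloc n k} (hS : PartlyFeasible π wb S) {V' : Finset (Fin n)} {v : Fin n}
    (hv : v ∈ (resolveRound π wb S V').2) :
    1 / 2 < conflict wb (later π v) (resolveRound π wb S V').1 (S v) v := by
  obtain ⟨hvV, hne⟩ := mem_resolveRound_snd.mp hv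
  rw [resolveRound_eq_foldl, foldl_roundStep_fst] at hne ⊢
  set S' : Alloc n k := fun v => if v ∈ V' then S v else ∅ with hS'
  have hS'v : S' v = S v := if_pos hvV
  have hsub (u : Fin n) : S' u ⊆ S u := by rw [hS']; dsimp only; split_ifs <;> simp
  rw [← hS'v] at hne ⊢
  have hsum := le_conflict_of_prune_ne hwb hself (roundOrder_pairwise π V') hne
  have hearlier : conflict wb (earlier π v) S' (S' v) v < 1 / 2 := by
    rw [hS'v]
    exact (conflict_mono hwb fun u _ => hsub u).trans_lt (hS v)
  linarith

theorem sum_conflict_later_le (hwb : ∀ u v, 0 ≤ wb u v) (hsymm : ∀ u v, wb u v = wb v u)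
    (W K : Finset (Fin n)) (S : Alloc n k) :
    ∑ v ∈ W, conflict wb (later π v) (fun u => if u ∈ K then S u else ∅) (S v) v ≤
      ∑ u ∈ K, conflict wb (earlier π u) S (S u) u := by
  calc ∑ v ∈ W, conflict wb (later π v) (fun u => if u ∈ K then S u else ∅) (S v) v
      = ∑ v ∈ W, ∑ u ∈ K with π v < π u ∧ (S u ∩ S v).Nonempty, wb v u := by
        refine Finset.sum_congr rfl fun v _ => ?_
        refine Finset.sum_congr ?_ fun u _ => hsymm u v
        ext u
        by_cases hu : u ∈ K <;> simp [hu, Finset.inter_comm]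
    _ ≤ ∑ v, ∑ u ∈ K with π v < π u ∧ (S u ∩ S v).Nonempty, wb v u :=
        Finset.sum_le_sum_of_subset_of_nonneg (Finset.subset_univ _) fun v _ _ =>
          Finset.sum_nonneg fun u _ => hwb v u
    _ = ∑ u ∈ K, conflict wb (earlier π u) S (S u) u :=
        Finset.sum_comm' fun v u => by
          simp only [Finset.mem_filter, Finset.mem_univ, true_and]
          tauto

/-- A link left over by the round has conflict more than `1 / 2` with later links that stay, but
these in turn have conflict less than `1 / 2` with earlier links. -/
theorem two_mul_card_resolveRound_le (hwb : ∀ u v, 0 ≤ wb u v) (hself : ∀ v, wb v v = 0)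
    (hsymm : ∀ u v, wb u v = wb v u) {S : Alloc n k} (hS : PartlyFeasible π wb S)
    (V' : Finset (Fin n)) : 2 * (resolveRound π wb S V').2.card ≤ V'.card := by
  set W := (resolveRound π wb S V').2
  have hA : (resolveRound π wb S V').1 = fun u => if u ∈ V' \ W then S u else ∅ :=
    funext (resolveRound_fst_apply π wb S V')
  have hle : (W.card : ℝ) * (1 / 2) ≤ (V' \ W).card * (1 / 2) := by
    calc (W.card : ℝ) * (1 / 2)
        ≤ ∑ v ∈ W, conflict wb (later π v) (resolveRound π wb S V').1 (S v) v := by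
          rw [← nsmul_eq_mul]
          exact Finset.card_nsmul_le_sum _ _ _ fun v hv =>
            (half_lt_conflict_later_resolveRound hwb hself hS hv).le
      _ ≤ ∑ u ∈ V' \ W, conflict wb (earlier π u) S (S u) u := by
          rw [hA]
          exact sum_conflict_later_le hwb hsymm W (V' \ W) S
      _ ≤ (V' \ W).card * (1 / 2) := by
          rw [← nsmul_eq_mul]
          exact Finset.sum_le_card_nsmul _ _ _ fun u _ => (hS u).le
  have hcard : W.card ≤ (V' \ W).card :=
    Nat.cast_le.mp (le_of_mul_le_mul_right hle one_half_pos)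
  have hcard_add : (V' \ W).card + W.card = V'.card :=
    Finset.card_sdiff_add_card_eq_card (resolveRound_snd_subset π wb S V')
  omega

theorem conflict_lt_of_mem_candidates (hwb : ∀ u v, 0 ≤ wb u v) {S : Alloc n k} {m : ℕ}
    {V' : Finset (Fin n)} {A : Alloc n k} (hA : A ∈ candidates π wb S m V') (v : Fin n) :
    conflict wb Finset.univ A (A v) v < 1 := by
  induction m generalizing V' with
  | zero => exact absurd hA List.not_mem_nil
  | succ m ih =>
    unfold candidates at hA
    split_ifs at hA with h
    · exact absurd hA List.not_mem_nil
    · rcases List.mem_cons.mp hA with rfl | hA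
      exacts [conflict_resolveRound_lt hwb π S V' v, ih hA]

theorem sum_sdiff_resolveRound_le_welfare (π : Fin n ≃ Fin n) (wb : Fin n → Fin n → ℝ)
    (b : Fin n → Finset (Fin k) → ℕ) (S : Alloc n k) (V' : Finset (Fin n)) :
    ∑ v ∈ V' \ (resolveRound π wb S V').2, b v (S v) ≤
      welfare b (resolveRound π wb S V').1 := by
  calc ∑ v ∈ V' \ (resolveRound π wb S V').2, b v (S v)
      = ∑ v ∈ V' \ (resolveRound π wb S V').2, b v ((resolveRound π wb S V').1 v) :=
        Finset.sum_congr rfl fun v hv => by rw [resolveRound_fst_apply π wb S V' v, if_pos hv]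
    _ ≤ welfare b (resolveRound π wb S V').1 :=
        Finset.sum_le_sum_of_subset (Finset.subset_univ _)

theorem sum_le_of_forall_candidates (hwb : ∀ u v, 0 ≤ wb u v) (hself : ∀ v, wb v v = 0)
    (hsymm : ∀ u v, wb u v = wb v u) {b : Fin n → Finset (Fin k) → ℕ} {S : Alloc n k}
    (hS : PartlyFeasible π wb S) {B m i : ℕ} {V' : Finset (Fin n)}
    (hB : ∀ A ∈ candidates π wb S m V', welfare b A ≤ B) (hi : V'.card < 2 ^ i) (him : i ≤ m) :
    ∑ v ∈ V', b v (S v) ≤ i * B := by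
  induction m generalizing V' i with
  | zero =>
    obtain rfl : i = 0 := Nat.le_zero.mp him
    obtain rfl : V' = ∅ := Finset.card_eq_zero.mp (by simpa using hi)
    simp
  | succ m ih =>
    rcases V'.eq_empty_or_nonempty with rfl | hV
    · simp
    rw [candidates, if_neg hV.ne_empty] at hB
    obtain ⟨i, rfl⟩ : ∃ i', i = i' + 1 := by
      refine Nat.exists_eq_succ_of_ne_zero ?_
      rintro rfl
      exact hi.not_ge (by simpa using hV.card_pos)
    have hhalf := two_mul_card_resolveRound_le hwb hself hsymm hS V'
    have hrest := ih (V' := (resolveRound π wb S V').2) (i := i)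
      (fun A hA => hB A (List.mem_cons_of_mem _ hA)) (by rw [pow_succ] at hi; omega) (by omega)
    have hfirst := (sum_sdiff_resolveRound_le_welfare π wb b S V').trans
      (hB _ List.mem_cons_self)
    rw [← Finset.sum_sdiff (resolveRound_snd_subset π wb S V'), add_mul, one_mul, add_comm]
    exact add_le_add hrest hfirst

theorem makeFeasible_mem_argmax (hn : 1 ≤ n) (π : Fin n ≃ Fin n) (wb : Fin n → Fin n → ℝ)
    (b : Fin n → Finset (Fin k) → ℕ) (S : Alloc n k) :
    makeFeasible π wb b S ∈ (candidates π wb S n Finset.univ).argmax (welfare b) := by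
  obtain ⟨m, rfl⟩ := Nat.exists_eq_add_of_le' hn
  have hne : candidates π wb S (m + 1) Finset.univ ≠ [] := by
    rw [candidates, if_neg Finset.univ_nonempty.ne_empty]
    exact List.cons_ne_nil _ _
  obtain ⟨A, hA⟩ : ∃ A, (candidates π wb S (m + 1) Finset.univ).argmax (welfare b) = some A :=
    Option.ne_none_iff_exists'.mp (mt List.argmax_eq_none.mp hne)
  rw [makeFeasible, hA]
  rfl

theorem conflict_makeFeasible_lt (hn : 1 ≤ n) (hwb : ∀ u v, 0 ≤ wb u v) (π : Fin n ≃ Fin n)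
    (b : Fin n → Finset (Fin k) → ℕ) (S : Alloc n k) (v : Fin n) :
    conflict wb Finset.univ (makeFeasible π wb b S) (makeFeasible π wb b S v) v < 1 :=
  conflict_lt_of_mem_candidates hwb (List.argmax_mem (makeFeasible_mem_argmax hn π wb b S)) v

theorem welfare_le_makeFeasible (hn : 1 ≤ n) (hwb : ∀ u v, 0 ≤ wb u v) (hself : ∀ v, wb v v = 0)
    (hsymm : ∀ u v, wb u v = wb v u) (b : Fin n → Finset (Fin k) → ℕ) {S : Alloc n k}
    (hS : PartlyFeasible π wb S) :
    welfare b S ≤ (Nat.log 2 n + 1) * welfare b (makeFeasible π wb b S) := by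
  refine sum_le_of_forall_candidates hwb hself hsymm hS (m := n)
    (fun A hA => List.le_of_mem_argmax hA (makeFeasible_mem_argmax hn π wb b S)) ?_ ?_
  · rw [Finset.card_fin]
    exact Nat.lt_pow_succ_log_self one_lt_two n
  · exact Nat.log_lt_self 2 (by omega)

theorem sum_channelSet_output_lt (hn : 1 ≤ n) (hwb : ∀ u v, 0 ≤ wb u v) {π : Fin n ≃ Fin n}
    {b : Fin n → Finset (Fin k) → ℕ} {S₁ S₂ : Alloc n k} {j : Fin k} {v : Fin n}
    (hv : v ∈ channelSet (output π wb b S₁ S₂) j) :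
    ∑ u ∈ channelSet (output π wb b S₁ S₂) j, wb u v < 1 := by
  refine lt_of_le_of_lt ?_ (conflict_makeFeasible_lt hn hwb π b
    (better b (partialResolve π wb S₁) (partialResolve π wb S₂)) v)
  refine Finset.sum_le_sum_of_subset_of_nonneg (fun u hu => ?_) fun u _ _ => hwb u v
  simp only [channelSet, Finset.mem_filter, Finset.mem_univ, true_and] at hu hv ⊢
  exact ⟨j, Finset.mem_inter.mpr ⟨hv, hu⟩⟩

theorem welfare_better (b : Fin n → Finset (Fin k) → ℕ) (S₁ S₂ : Alloc n k) :
    welfare b (better b S₁ S₂) = max (welfare b S₁) (welfare b S₂) := by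
  unfold better
  split_ifs with h
  exacts [(max_eq_left h).symm, (max_eq_right (le_of_not_ge h)).symm]

theorem max_welfare_partialResolve_le (hn : 1 ≤ n) (hwb : ∀ u v, 0 ≤ wb u v)
    (hself : ∀ v, wb v v = 0) (hsymm : ∀ u v, wb u v = wb v u) (π : Fin n ≃ Fin n)
    (b : Fin n → Finset (Fin k) → ℕ) (S₁ S₂ : Alloc n k) :
    max (welfare b (partialResolve π wb S₁)) (welfare b (partialResolve π wb S₂)) ≤
      (Nat.log 2 n + 1) * welfare b (output π wb b S₁ S₂) := by
  rw [← welfare_better]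
  refine welfare_le_makeFeasible hn hwb hself hsymm b ?_
  unfold better
  split_ifs
  exacts [partlyFeasible_partialResolve hwb π S₁, partlyFeasible_partialResolve hwb π S₂]

end Conflicts

/-! ### Independent random choices -/

section ProductMean

variable {ι Ω : Type*} [Fintype ι] [DecidableEq ι] [Fintype Ω] {q : ι → Ω → ℝ}

/-- The expectation of `F S` if the values `S v` are chosen independently, `S v` with distribution
`q v`. -/
noncomputable def productMean (q : ι → Ω → ℝ) (F : (ι → Ω) → ℝ) : ℝ :=
  ∑ S, (∏ v, q v (S v)) * F S

theorem productMean_mono (hq : ∀ v T, 0 ≤ q v T) {F G : (ι → Ω) → ℝ} (h : ∀ S, F S ≤ G S) :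
    productMean q F ≤ productMean q G :=
  Finset.sum_le_sum fun S _ =>
    mul_le_mul_of_nonneg_left (h S) (Finset.prod_nonneg fun v _ => hq v (S v))

theorem productMean_sub (q : ι → Ω → ℝ) (F G : (ι → Ω) → ℝ) :
    productMean q (fun S => F S - G S) = productMean q F - productMean q G := by
  simp only [productMean, mul_sub, Finset.sum_sub_distrib]

theorem productMean_const_mul (q : ι → Ω → ℝ) (c : ℝ) (F : (ι → Ω) → ℝ) :
    productMean q (fun S => c * F S) = c * productMean q F := by
  simp only [productMean, Finset.mul_sum, mul_left_comm]

theorem productMean_sum {κ : Type*} (q : ι → Ω → ℝ) (I : Finset κ) (F : κ → (ι → Ω) → ℝ) :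
    productMean q (fun S => ∑ i ∈ I, F i S) = ∑ i ∈ I, productMean q (F i) := by
  simp only [productMean, Finset.mul_sum]
  exact Finset.sum_comm

theorem productMean_prod (q g : ι → Ω → ℝ) :
    productMean q (fun S => ∏ v, g v (S v)) = ∏ v, ∑ T, q v T * g v T := by
  rw [Finset.prod_univ_sum, Fintype.piFinset_univ]
  simp only [productMean, Finset.prod_mul_distrib]

theorem productMean_const (hq : ∀ v, ∑ T, q v T = 1) (c : ℝ) : productMean q (fun _ => c) = c := by
  have hone := productMean_prod q fun _ _ => 1
  simp only [Finset.prod_const_one, mul_one, hq] at hone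
  simpa only [mul_one, hone] using productMean_const_mul q c fun _ => 1

theorem productMean_apply (hq : ∀ v, ∑ T, q v T = 1) (v : ι) (f : Ω → ℝ) :
    productMean q (fun S => f (S v)) = ∑ T, q v T * f T := by
  have h := productMean_prod q fun w T => if w = v then f T else 1
  simp only [Finset.prod_ite_eq', Finset.mem_univ, if_true] at h
  rw [h, Fintype.prod_eq_single v fun w hw => by simp [hw, hq]]
  simp

theorem productMean_mul (hq : ∀ v, ∑ T, q v T = 1) {u v : ι} (hvu : v ≠ u) (f g : Ω → ℝ) :
    productMean q (fun S => f (S v) * g (S u)) = (∑ T, q v T * f T) * ∑ T, q u T * g T := by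
  have h := productMean_prod q fun w T => (if w = v then f T else 1) * if w = u then g T else 1
  simp only [Finset.prod_mul_distrib, Finset.prod_ite_eq', Finset.mem_univ, if_true] at h
  rw [h, Fintype.prod_eq_mul v u hvu fun w hw => by simp [hw.1, hw.2, hq]]
  simp [hvu, hvu.symm]

theorem productMean_apply₂ (hq : ∀ v, ∑ T, q v T = 1) {u v : ι} (hvu : v ≠ u) (F : Ω → Ω → ℝ) :
    productMean q (fun S => F (S v) (S u)) = ∑ T, q v T * ∑ T', q u T' * F T T' := by
  classical
  have hF (S : ι → Ω) : F (S v) (S u) = ∑ T, (if S v = T then 1 else 0) * F T (S u) := by simp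
  simp only [hF, productMean_sum]
  refine Finset.sum_congr rfl fun T _ => ?_
  rw [productMean_mul hq hvu (fun T' => if T' = T then 1 else 0) (F T)]
  simp

end ProductMean

/-! ### Expected loss in partial conflict resolution -/

section Rounding

variable {n k : ℕ} {π : Fin n ≃ Fin n} {wb : Fin n → Fin n → ℝ} {ρ : ℝ}
  {q x y : Fin n → Finset (Fin k) → ℝ}

/-- The expected value of `conflict wb I S T v` for a random allocation `S` in which `S u` has
distribution `q u`. -/
noncomputable def expectedConflict (wb : Fin n → Fin n → ℝ) (q : Fin n → Finset (Fin k) → ℝ)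
    (I : Finset (Fin n)) (T : Finset (Fin k)) (v : Fin n) : ℝ :=
  ∑ u ∈ I, wb u v * ∑ T' with (T ∩ T').Nonempty, q u T'

theorem productMean_mul_conflict (hq : ∀ v, ∑ T, q v T = 1) {I : Finset (Fin n)} {v : Fin n}
    (hv : v ∉ I) (f : Finset (Fin k) → ℝ) :
    productMean q (fun S => f (S v) * conflict wb I S (S v) v) =
      ∑ T, q v T * (f T * expectedConflict wb q I T v) := by
  have hsum (S : Alloc n k) : f (S v) * conflict wb I S (S v) v =
      ∑ u ∈ I, wb u v * (f (S v) * if (S v ∩ S u).Nonempty then 1 else 0) := by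
    rw [conflict, Finset.sum_filter, Finset.mul_sum]
    refine Finset.sum_congr rfl fun u _ => ?_
    split_ifs <;> ring
  have hmean : ∀ u ∈ I,
      wb u v * productMean q (fun S => f (S v) * if (S v ∩ S u).Nonempty then 1 else 0) =
        wb u v * ∑ T, q v T * (f T * ∑ T' with (T ∩ T').Nonempty, q u T') := by
    intro u hu
    congr 1
    rw [productMean_apply₂ hq (ne_of_mem_of_not_mem hu hv).symm fun T T' =>
      f T * if (T ∩ T').Nonempty then 1 else 0]
    simp only [Finset.sum_filter, Finset.mul_sum]
    refine Finset.sum_congr rfl fun T _ => Finset.sum_congr rfl fun T' _ => ?_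
    split_ifs <;> ring
  simp only [hsum, productMean_sum, productMean_const_mul]
  rw [Finset.sum_congr rfl hmean]
  simp only [expectedConflict, Finset.mul_sum]
  rw [Finset.sum_comm]
  refine Finset.sum_congr rfl fun T _ => Finset.sum_congr rfl fun u _ =>
    Finset.sum_congr rfl fun T' _ => ?_
  ring

/-- The pointwise form of Markov's inequality for the event that `v` is removed. -/
theorem sub_two_mul_conflict_le_partialResolve (hwb : ∀ u v, 0 ≤ wb u v) (π : Fin n ≃ Fin n)
    (b : Fin n → Finset (Fin k) → ℕ) (S : Alloc n k) (v : Fin n) :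
    (b v (S v) : ℝ) - 2 * (b v (S v) * conflict wb (earlier π v) S (S v) v) ≤
      b v (partialResolve π wb S v) := by
  have hb : (0 : ℝ) ≤ b v (S v) := Nat.cast_nonneg _
  rcases lt_or_ge (conflict wb (earlier π v) S (S v) v) (1 / 2) with h | h
  · rw [partialResolve_eq_self hwb h]
    have h₀ : 0 ≤ conflict wb (earlier π v) S (S v) v := Finset.sum_nonneg fun u _ => hwb u v
    linarith [mul_nonneg hb h₀]
  · have hb' : (0 : ℝ) ≤ b v (partialResolve π wb S v) := Nat.cast_nonneg _
    linarith [mul_le_mul_of_nonneg_left h hb, hb']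

theorem half_sum_le_productMean_welfare (hwb : ∀ u v, 0 ≤ wb u v)
    (b : Fin n → Finset (Fin k) → ℕ) (hq₀ : ∀ v T, 0 ≤ q v T) (hq₁ : ∀ v, ∑ T, q v T = 1)
    (hconf : ∀ v T, q v T ≠ 0 → expectedConflict wb q (earlier π v) T v ≤ 1 / 4) :
    1 / 2 * ∑ v, ∑ T, q v T * b v T ≤
      productMean q fun S => (welfare b (partialResolve π wb S) : ℝ) := by
  have hbundle (v : Fin n) (T : Finset (Fin k)) : 1 / 2 * (q v T * b v T) ≤
      q v T * b v T - 2 * (q v T * (b v T * expectedConflict wb q (earlier π v) T v)) := by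
    by_cases hT : q v T = 0
    · simp [hT]
    · have hqb : 0 ≤ q v T * b v T := mul_nonneg (hq₀ v T) (Nat.cast_nonneg _)
      linarith [mul_le_mul_of_nonneg_left (hconf v T hT) hqb]
  simp only [welfare, Nat.cast_sum, productMean_sum, Finset.mul_sum (Finset.univ : Finset (Fin n))]
  refine Finset.sum_le_sum fun v _ => ?_
  calc 1 / 2 * ∑ T, q v T * b v T
      ≤ ∑ T, q v T * b v T -
          2 * ∑ T, q v T * (b v T * expectedConflict wb q (earlier π v) T v) := by
        rw [Finset.mul_sum, Finset.mul_sum, ← Finset.sum_sub_distrib]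
        exact Finset.sum_le_sum fun T _ => hbundle v T
    _ = productMean q fun S =>
          (b v (S v) : ℝ) - 2 * (b v (S v) * conflict wb (earlier π v) S (S v) v) := by
        rw [productMean_sub, productMean_const_mul, productMean_apply hq₁ v fun T => (b v T : ℝ),
          productMean_mul_conflict hq₁ (by simp) fun T => (b v T : ℝ)]
    _ ≤ productMean q fun S => (b v (partialResolve π wb S v) : ℝ) :=
        productMean_mono hq₀ fun S => sub_two_mul_conflict_le_partialResolve hwb π b S v

/-! ### Rounding an LP solution -/

theorem sum_roundProb (ρ : ℝ) (y : Fin n → Finset (Fin k) → ℝ) (v : Fin n) :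
    ∑ T, roundProb ρ y v T = 1 := by
  have h : ∑ T ∈ Finset.univ.erase ∅, roundProb ρ y v T =
      ∑ T ∈ Finset.univ.erase ∅, y v T / (4 * Real.sqrt k * ρ) :=
    Finset.sum_congr rfl fun T hT => if_neg (Finset.ne_of_mem_erase hT)
  rw [← Finset.add_sum_erase _ _ (Finset.mem_univ ∅), h, roundProb, if_pos rfl, sub_add_cancel]

theorem div_le_roundProb (hρ : 1 ≤ 4 * Real.sqrt k * ρ) (hy : ∀ v, ∑ T, y v T ≤ 1) (v : Fin n)
    (T : Finset (Fin k)) : y v T / (4 * Real.sqrt k * ρ) ≤ roundProb ρ y v T := by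
  unfold roundProb
  split_ifs with hT
  · rw [hT, le_sub_iff_add_le, Finset.add_sum_erase _ (fun T => y v T / (4 * Real.sqrt k * ρ))
      (Finset.mem_univ ∅), ← Finset.sum_div, div_le_one (one_pos.trans_le hρ)]
    exact (hy v).trans hρ
  · exact le_rfl

theorem LPFeasible.roundProb_nonneg (hy : LPFeasible π wb ρ y) (hρ : 1 ≤ 4 * Real.sqrt k * ρ)
    (v : Fin n) (T : Finset (Fin k)) : 0 ≤ roundProb ρ y v T :=
  (div_nonneg (hy.2.2 v T) (one_pos.trans_le hρ).le).trans (div_le_roundProb hρ hy.2.1 v T)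

theorem expectedConflict_empty (wb : Fin n → Fin n → ℝ) (q : Fin n → Finset (Fin k) → ℝ)
    (I : Finset (Fin n)) (v : Fin n) : expectedConflict wb q I ∅ v = 0 := by
  simp [expectedConflict]

theorem expectedConflict_roundProb (wb : Fin n → Fin n → ℝ) (ρ : ℝ)
    (y : Fin n → Finset (Fin k) → ℝ) (I : Finset (Fin n)) (T : Finset (Fin k)) (v : Fin n) :
    expectedConflict wb (roundProb ρ y) I T v =
      expectedConflict wb y I T v / (4 * Real.sqrt k * ρ) := by
  simp only [expectedConflict, Finset.sum_div, mul_div_assoc]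
  refine Finset.sum_congr rfl fun u _ => ?_
  congr 1
  refine Finset.sum_congr rfl fun T' hT' => if_neg ?_
  rintro rfl
  simp at hT'

theorem LPFeasible.lpValue_le (hy : LPFeasible π wb ρ y) (hρ : 1 ≤ 4 * Real.sqrt k * ρ)
    (hwb : ∀ u v, 0 ≤ wb u v) (b : Fin n → Finset (Fin k) → ℕ)
    (hconf : ∀ v T, y v T ≠ 0 → expectedConflict wb y (earlier π v) T v ≤ Real.sqrt k * ρ) :
    lpValue b y ≤ 8 * Real.sqrt k * ρ *
      productMean (roundProb ρ y) fun S => (welfare b (partialResolve π wb S) : ℝ) := by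
  have hc : 0 < 4 * Real.sqrt k * ρ := one_pos.trans_le hρ
  have hconf_round (v : Fin n) (T : Finset (Fin k)) (hT : roundProb ρ y v T ≠ 0) :
      expectedConflict wb (roundProb ρ y) (earlier π v) T v ≤ 1 / 4 := by
    rcases eq_or_ne T ∅ with rfl | hne
    · simp [expectedConflict_empty]
    rw [roundProb, if_neg hne] at hT
    rw [expectedConflict_roundProb, div_le_iff₀ hc]
    linarith [hconf v T fun h => hT (by rw [h, zero_div])]
  have hhalf := half_sum_le_productMean_welfare hwb b (hy.roundProb_nonneg hρ) (sum_roundProb ρ y)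
    hconf_round
  have hvalue : lpValue b y ≤ 4 * Real.sqrt k * ρ * ∑ v, ∑ T, roundProb ρ y v T * b v T := by
    simp only [lpValue, Finset.mul_sum]
    refine Finset.sum_le_sum fun v _ => Finset.sum_le_sum fun T _ => ?_
    rw [← mul_assoc, mul_comm]
    exact mul_le_mul_of_nonneg_right ((div_le_iff₀' hc).mp (div_le_roundProb hρ hy.2.1 v T))
      (Nat.cast_nonneg _)
  linarith [mul_le_mul_of_nonneg_left hhalf hc.le]

theorem LPFeasible.sum_card_inter_mul_le (hy : LPFeasible π wb ρ y) (J : Finset (Fin k))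
    (v : Fin n) :
    ∑ u ∈ earlier π v, wb u v * ∑ T, ((J ∩ T).card : ℝ) * y u T ≤ J.card * ρ := by
  have hcard (T : Finset (Fin k)) : ((J ∩ T).card : ℝ) = ∑ j ∈ J, if j ∈ T then 1 else 0 := by
    simp
  calc ∑ u ∈ earlier π v, wb u v * ∑ T, ((J ∩ T).card : ℝ) * y u T
      = ∑ u ∈ earlier π v, ∑ j ∈ J, ∑ T with j ∈ T, wb u v * y u T := by
        refine Finset.sum_congr rfl fun u _ => ?_
        simp only [hcard, Finset.sum_mul, Finset.mul_sum, Finset.sum_filter]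
        rw [Finset.sum_comm]
        refine Finset.sum_congr rfl fun j _ => Finset.sum_congr rfl fun T _ => ?_
        split_ifs <;> simp
    _ = ∑ j ∈ J, ∑ u ∈ earlier π v, ∑ T with j ∈ T, wb u v * y u T := Finset.sum_comm
    _ ≤ J.card * ρ := by
        rw [← nsmul_eq_mul]
        exact Finset.sum_le_card_nsmul _ _ _ fun j _ => hy.1 v j

theorem LPFeasible.expectedConflict_le (hy : LPFeasible π wb ρ y) (hwb : ∀ u v, 0 ≤ wb u v)
    (v : Fin n) (T : Finset (Fin k)) :
    expectedConflict wb y (earlier π v) T v ≤ T.card * ρ := by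
  refine le_trans ?_ (hy.sum_card_inter_mul_le T v)
  refine Finset.sum_le_sum fun u _ => mul_le_mul_of_nonneg_left ?_ (hwb u v)
  rw [Finset.sum_filter]
  refine Finset.sum_le_sum fun T' _ => ?_
  split_ifs with hTT
  · exact le_mul_of_one_le_left (hy.2.2 u T') (by exact_mod_cast hTT.card_pos)
  · exact mul_nonneg (Nat.cast_nonneg _) (hy.2.2 u T')

theorem LPFeasible.mul_expectedConflict_le (hy : LPFeasible π wb ρ y) (hwb : ∀ u v, 0 ≤ wb u v)
    {c : ℝ} (hc : ∀ u T, y u T ≠ 0 → c ≤ T.card) (v : Fin n) (T : Finset (Fin k)) :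
    c * expectedConflict wb y (earlier π v) T v ≤ k * ρ := by
  refine le_trans ?_ ((hy.sum_card_inter_mul_le Finset.univ v).trans_eq (by rw [Finset.card_fin]))
  rw [expectedConflict, Finset.mul_sum]
  refine Finset.sum_le_sum fun u _ => ?_
  rw [mul_left_comm, Finset.mul_sum]
  refine mul_le_mul_of_nonneg_left ?_ (hwb u v)
  rw [Finset.sum_filter]
  refine Finset.sum_le_sum fun T' _ => ?_
  rw [Finset.univ_inter]
  split_ifs
  · by_cases hT' : y u T' = 0
    · simp [hT']
    · exact mul_le_mul_of_nonneg_right (hc u T' hT') (hy.2.2 u T')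
  · exact mul_nonneg (Nat.cast_nonneg _) (hy.2.2 u T')

theorem smallPart_nonneg (hx : ∀ v T, 0 ≤ x v T) (v : Fin n) (T : Finset (Fin k)) :
    0 ≤ smallPart x v T := by
  unfold smallPart
  split_ifs
  exacts [hx v T, le_rfl]

theorem smallPart_le (hx : ∀ v T, 0 ≤ x v T) (v : Fin n) (T : Finset (Fin k)) :
    smallPart x v T ≤ x v T := by
  unfold smallPart
  split_ifs
  exacts [le_rfl, hx v T]

theorem LPFeasible.mono (hx : LPFeasible π wb ρ x) (hwb : ∀ u v, 0 ≤ wb u v)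
    (hy : ∀ v T, 0 ≤ y v T) (hyx : ∀ v T, y v T ≤ x v T) : LPFeasible π wb ρ y :=
  ⟨fun v j => (Finset.sum_le_sum fun u _ => Finset.sum_le_sum fun T _ =>
      mul_le_mul_of_nonneg_left (hyx u T) (hwb u v)).trans (hx.1 v j),
    fun v => (Finset.sum_le_sum fun T _ => hyx v T).trans (hx.2.1 v), hy⟩

theorem LPFeasible.smallPart (hx : LPFeasible π wb ρ x) (hwb : ∀ u v, 0 ≤ wb u v) :
    LPFeasible π wb ρ (smallPart x) :=
  hx.mono hwb (smallPart_nonneg hx.2.2) (smallPart_le hx.2.2)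

theorem LPFeasible.largePart (hx : LPFeasible π wb ρ x) (hwb : ∀ u v, 0 ≤ wb u v) :
    LPFeasible π wb ρ (largePart x) :=
  hx.mono hwb (fun v T => sub_nonneg.mpr (smallPart_le hx.2.2 v T))
    fun v T => sub_le_self _ (smallPart_nonneg hx.2.2 v T)

theorem card_le_of_smallPart_ne_zero {v : Fin n} {T : Finset (Fin k)} (h : smallPart x v T ≠ 0) :
    (T.card : ℝ) ≤ Real.sqrt k := by
  by_contra hT
  exact h (if_neg hT)

theorem le_card_of_largePart_ne_zero {v : Fin n} {T : Finset (Fin k)} (h : largePart x v T ≠ 0) :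
    Real.sqrt k ≤ T.card := by
  by_contra! hT
  exact h (by rw [largePart, smallPart, if_pos hT.le, sub_self])

theorem lpValue_smallPart_le (hρ₀ : 0 ≤ ρ) (hρ : 1 ≤ 4 * Real.sqrt k * ρ)
    (hwb : ∀ u v, 0 ≤ wb u v) (b : Fin n → Finset (Fin k) → ℕ) (hx : LPFeasible π wb ρ x) :
    lpValue b (smallPart x) ≤ 8 * Real.sqrt k * ρ *
      productMean (roundProb ρ (smallPart x)) fun S => (welfare b (partialResolve π wb S) : ℝ) :=
  (hx.smallPart hwb).lpValue_le hρ hwb b fun v T hT =>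
    ((hx.smallPart hwb).expectedConflict_le hwb v T).trans
      (mul_le_mul_of_nonneg_right (card_le_of_smallPart_ne_zero hT) hρ₀)

theorem lpValue_largePart_le (hk : 1 ≤ k) (hρ : 1 ≤ 4 * Real.sqrt k * ρ)
    (hwb : ∀ u v, 0 ≤ wb u v) (b : Fin n → Finset (Fin k) → ℕ) (hx : LPFeasible π wb ρ x) :
    lpValue b (largePart x) ≤ 8 * Real.sqrt k * ρ *
      productMean (roundProb ρ (largePart x)) fun S => (welfare b (partialResolve π wb S) : ℝ) := by
  refine (hx.largePart hwb).lpValue_le hρ hwb b fun v T _ => ?_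
  have h := (hx.largePart hwb).mul_expectedConflict_le hwb
    (fun _ _ => le_card_of_largePart_ne_zero) v T
  have hkρ : (k : ℝ) * ρ = Real.sqrt k * (Real.sqrt k * ρ) := by
    rw [← mul_assoc, Real.mul_self_sqrt (Nat.cast_nonneg k)]
  rw [hkρ] at h
  exact le_of_mul_le_mul_left h (Real.sqrt_pos.mpr (Nat.cast_pos.mpr hk))

theorem lpValue_eq_add (b : Fin n → Finset (Fin k) → ℕ) (x : Fin n → Finset (Fin k) → ℝ) :
    lpValue b x = lpValue b (smallPart x) + lpValue b (largePart x) := by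
  simp only [lpValue, ← Finset.sum_add_distrib, ← mul_add, largePart, add_sub_cancel]

theorem expectedWelfare_eq_productMean (π : Fin n ≃ Fin n) (wb : Fin n → Fin n → ℝ) (ρ : ℝ)
    (b : Fin n → Finset (Fin k) → ℕ) (x : Fin n → Finset (Fin k) → ℝ) :
    expectedWelfare π wb ρ b x =
      productMean (roundProb ρ (smallPart x)) fun S₁ =>
        productMean (roundProb ρ (largePart x)) fun S₂ =>
          (welfare b (output π wb b S₁ S₂) : ℝ) := by
  simp only [expectedWelfare, roundingProb, productMean, Finset.mul_sum, mul_assoc]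

theorem LPFeasible.expectedWelfare_nonneg (hx : LPFeasible π wb ρ x)
    (hρ : 1 ≤ 4 * Real.sqrt k * ρ) (hwb : ∀ u v, 0 ≤ wb u v)
    (b : Fin n → Finset (Fin k) → ℕ) : 0 ≤ expectedWelfare π wb ρ b x :=
  Finset.sum_nonneg fun _ _ => Finset.sum_nonneg fun _ _ => mul_nonneg (mul_nonneg
    (Finset.prod_nonneg fun _ _ => (hx.smallPart hwb).roundProb_nonneg hρ _ _)
    (Finset.prod_nonneg fun _ _ => (hx.largePart hwb).roundProb_nonneg hρ _ _))
    (Nat.cast_nonneg _)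

theorem max_productMean_welfare_le (hn : 1 ≤ n) (hρ : 1 ≤ 4 * Real.sqrt k * ρ)
    (hwb : ∀ u v, 0 ≤ wb u v) (hself : ∀ v, wb v v = 0) (hsymm : ∀ u v, wb u v = wb v u)
    (b : Fin n → Finset (Fin k) → ℕ) (hx : LPFeasible π wb ρ x) :
    max (productMean (roundProb ρ (smallPart x)) fun S => (welfare b (partialResolve π wb S) : ℝ))
        (productMean (roundProb ρ (largePart x)) fun S => (welfare b (partialResolve π wb S) : ℝ)) ≤
      (Nat.log 2 n + 1) * expectedWelfare π wb ρ b x := by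
  have hsmall := (hx.smallPart hwb).roundProb_nonneg hρ
  have hlarge := (hx.largePart hwb).roundProb_nonneg hρ
  have hout (S₁ S₂ : Alloc n k) :
      max (welfare b (partialResolve π wb S₁) : ℝ) (welfare b (partialResolve π wb S₂)) ≤
        (Nat.log 2 n + 1) * welfare b (output π wb b S₁ S₂) := by
    exact_mod_cast max_welfare_partialResolve_le hn hwb hself hsymm π b S₁ S₂
  simp only [expectedWelfare_eq_productMean, ← productMean_const_mul]
  refine max_le (productMean_mono hsmall fun S₁ => ?_) ?_
  · rw [← productMean_const (sum_roundProb ρ (largePart x)) (welfare b _ : ℝ)]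
    exact productMean_mono hlarge fun S₂ => (le_max_left _ _).trans (hout S₁ S₂)
  · rw [← productMean_const (sum_roundProb ρ (smallPart x)) (productMean _ _)]
    exact productMean_mono hsmall fun S₁ => productMean_mono hlarge fun S₂ =>
      (le_max_right _ _).trans (hout S₁ S₂)

theorem lpValue_le_expectedWelfare (hn : 1 ≤ n) (hk : 1 ≤ k) (hρ₀ : 0 ≤ ρ)
    (hρ : 1 ≤ 4 * Real.sqrt k * ρ) (hwb : ∀ u v, 0 ≤ wb u v) (hself : ∀ v, wb v v = 0)
    (hsymm : ∀ u v, wb u v = wb v u) (b : Fin n → Finset (Fin k) → ℕ)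
    (hx : LPFeasible π wb ρ x) :
    lpValue b x ≤ 16 * Real.sqrt k * ρ * (Nat.log 2 n + 1) * expectedWelfare π wb ρ b x := by
  obtain ⟨hsmall, hlarge⟩ := max_le_iff.mp (max_productMean_welfare_le hn hρ hwb hself hsymm b hx)
  have hc : 0 ≤ 8 * Real.sqrt k * ρ := by linarith
  have h₁ := (lpValue_smallPart_le hρ₀ hρ hwb b hx).trans (mul_le_mul_of_nonneg_left hsmall hc)
  have h₂ := (lpValue_largePart_le hk hρ hwb b hx).trans (mul_le_mul_of_nonneg_left hlarge hc)
  rw [lpValue_eq_add]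
  linarith

/-! ### The linear program -/

theorem isCompact_setOf_lpFeasible (k : ℕ) (π : Fin n ≃ Fin n) (wb : Fin n → Fin n → ℝ) (ρ : ℝ) :
    IsCompact {x : Fin n → Finset (Fin k) → ℝ | LPFeasible π wb ρ x} := by
  refine IsCompact.of_isClosed_subset (isCompact_Icc (a := (0 : Fin n → Finset (Fin k) → ℝ))
    (b := 1)) ?_ fun x hx => ⟨fun v T => hx.2.2 v T, fun v T => ?_⟩
  · simp only [LPFeasible, Set.ofPred_and, Set.ofPred_forall]
    refine (isClosed_iInter fun v => isClosed_iInter fun j => isClosed_le ?_ continuous_const).inter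
      ((isClosed_iInter fun v => isClosed_le ?_ continuous_const).inter
        (isClosed_iInter fun v => isClosed_iInter fun T => isClosed_le continuous_const ?_)) <;>
      fun_prop
  · exact (Finset.single_le_sum (fun T _ => hx.2.2 v T) (Finset.mem_univ T)).trans (hx.2.1 v)

theorem exists_lpOptimal (π : Fin n ≃ Fin n) (wb : Fin n → Fin n → ℝ) (hρ : 0 ≤ ρ)
    (b : Fin n → Finset (Fin k) → ℕ) : ∃ x, LPOptimal π wb ρ b x := by
  have hzero : LPFeasible π wb ρ (0 : Fin n → Finset (Fin k) → ℝ) := by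
    simpa [LPFeasible] using fun _ _ => hρ
  have hcont : Continuous fun x : Fin n → Finset (Fin k) → ℝ => lpValue b x := by
    unfold lpValue
    fun_prop
  obtain ⟨x, hx, hmax⟩ := (isCompact_setOf_lpFeasible k π wb ρ).exists_isMaxOn
    ⟨0, hzero⟩ hcont.continuousOn
  exact ⟨x, hx, fun y hy => hmax hy⟩

theorem InductiveIndependenceLE.lpFeasible_indicator {F : Finset (Fin n) → Prop}
    (hF : InductiveIndependenceLE π wb F ρ) {S : Alloc n k} (hS : ∀ j, F (channelSet S j)) :
    LPFeasible π wb ρ fun v T => if T = S v then 1 else 0 := by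
  refine ⟨fun v j => (hF (channelSet S j) v (hS j)).trans_eq' ?_, fun v => by simp,
    fun v T => by dsimp only; split_ifs <;> norm_num⟩
  simp only [channelSet, mul_ite, mul_one, mul_zero, Finset.sum_ite_eq', Finset.mem_filter,
    Finset.mem_univ, true_and]
  rw [← Finset.sum_filter, Finset.filter_comm]

theorem LPOptimal.welfare_le {b : Fin n → Finset (Fin k) → ℕ} (hx : LPOptimal π wb ρ b x)
    {F : Finset (Fin n) → Prop} (hF : InductiveIndependenceLE π wb F ρ) {S : Alloc n k}
    (hS : ∀ j, F (channelSet S j)) : (welfare b S : ℝ) ≤ lpValue b x := by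
  refine le_of_eq_of_le ?_ (hx.2 _ (hF.lpFeasible_indicator hS))
  simp [lpValue, welfare]

end Rounding

/-! ### Approximation guarantees -/

theorem natLog_two_add_one_le {n : ℕ} (hn : 2 ≤ n) :
    (Nat.log 2 n : ℝ) + 1 ≤ 2 / Real.log 2 * Real.log n := by
  have hfloor : (Nat.log 2 n : ℝ) ≤ Real.log n / Real.log 2 := by
    have h := Real.natLog_le_logb n 2
    rwa [Real.logb, Nat.cast_ofNat] at h
  have hone : 1 ≤ Real.log n / Real.log 2 :=
    (one_le_div (Real.log_pos one_lt_two)).mpr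
      (Real.log_le_log two_pos (by exact_mod_cast hn))
  calc _ ≤ Real.log n / Real.log 2 + Real.log n / Real.log 2 := add_le_add hfloor hone
    _ = _ := by ring

/-- The parameter `τ` of the weights: small enough that a set of links on which all total weights
are less than `1` satisfies the SINR constraints under power control. -/
noncomputable def weightScale (α β : ℝ) : ℝ :=
  1 / (1 + 8 * β * 3 ^ α * (1 + 2 * β))

section WeightScale

variable {β : ℝ} (α : ℝ)

theorem weightScale_pos (hβ : 0 < β) : 0 < weightScale α β := by
  unfold weightScale
  positivity

theorem weightScale_le_one (hβ : 0 < β) : weightScale α β ≤ 1 := by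
  have h : 0 ≤ 8 * β * 3 ^ α * (1 + 2 * β) := by positivity
  rw [weightScale, div_le_one (by positivity)]
  linarith

theorem mul_weightScale_le_one (hβ : 0 < β) :
    8 * β * 3 ^ α * (1 + 2 * β) * weightScale α β ≤ 1 := by
  rw [weightScale, mul_one_div, div_le_one (by positivity)]
  linarith

end WeightScale

section Achieves

variable {X : Type*} [MetricSpace X] {n k : ℕ} {α β ν ρ : ℝ} {s r : Fin n → X} {π : Fin n ≃ Fin n}

theorem achieves_of_inductiveIndependenceLE (hα : 0 < α) (hβ : 0 < β) (hν : 0 ≤ ν) (hn : 2 ≤ n)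
    (hk : 1 ≤ k) (hρ : 1 ≤ ρ) (hsr : ∀ v, s v ≠ r v)
    (hind : InductiveIndependenceLE π (symmWeight (weight α (weightScale α β) s r π))
      (fun M => ∃ p, SINR α β ν s r M p) ρ)
    (b : Fin n → Finset (Fin k) → ℕ) :
    Achieves α β ν (weightScale α β) ρ s r π b
      (32 * ρ / Real.log 2 * (Real.sqrt k * Real.log n)) := by
  have hτ := weightScale_pos α hβ
  set wb := symmWeight (weight α (weightScale α β) s r π)
  have hwb : ∀ u v, 0 ≤ wb u v := symmWeight_nonneg (weight_nonneg hτ)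
  have hone : 1 ≤ 4 * Real.sqrt k * ρ := by
    nlinarith [Real.one_le_sqrt.mpr (Nat.one_le_cast.mpr hk : (1 : ℝ) ≤ k)]
  refine ⟨exists_lpOptimal π wb (by linarith) b, fun x hx => ⟨fun v T =>
    ⟨(hx.1.smallPart hwb).roundProb_nonneg hone v T,
      (hx.1.largePart hwb).roundProb_nonneg hone v T⟩, fun S₁ S₂ j => ?_, fun S hS => ?_⟩⟩
  · exact (wellSeparated_of_sum_symmWeight_lt_one hα hτ (weightScale_le_one α hβ) hsr
      fun v hv => sum_channelSet_output_lt (by omega) hwb hv).sinr_powerControl hα hβ hτ.le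
        (mul_weightScale_le_one α hβ) hν hsr
  · calc (welfare b S : ℝ) ≤ lpValue b x := hx.welfare_le hind hS
      _ ≤ 16 * Real.sqrt k * ρ * (Nat.log 2 n + 1) * expectedWelfare π wb ρ b x :=
          lpValue_le_expectedWelfare (by omega) hk (by linarith) hone hwb
            (symmWeight_weight_self α _ s r π) (symmWeight_comm _) b hx.1
      _ ≤ 16 * Real.sqrt k * ρ * (2 / Real.log 2 * Real.log n) * expectedWelfare π wb ρ b x := by
          gcongr
          · exact hx.1.expectedWelfare_nonneg hone hwb b
          · exact natLog_two_add_one_le hn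
      _ = _ := by ring

theorem achieves_of_hasPacking {C δ : ℝ} (hX : HasPacking X C δ) (hα : 0 < α) (hβ : 0 < β)
    (hδ : δ < α) (hν : 0 ≤ ν) (hn : 2 ≤ n) (hk : 1 ≤ k) (hsr : ∀ v, s v ≠ r v)
    (hπ : ∀ u v, π u < π v → dist (s v) (r v) ≤ dist (s u) (r u))
    (b : Fin n → Finset (Fin k) → ℕ) :
    Achieves α β ν (weightScale α β) (max 1 (fadingBound α β (weightScale α β) C δ)) s r π b
      (32 * max 1 (fadingBound α β (weightScale α β) C δ) / Real.log 2 *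
        (Real.sqrt k * Real.log n)) :=
  achieves_of_inductiveIndependenceLE hα hβ hν hn hk (le_max_left _ _) hsr
    ((hX.inductiveIndependenceLE hα hδ hβ hν (weightScale_pos α hβ) hsr hπ).mono
      (le_max_right _ _)) b

/-- The factor `c` of the LP parameter `ρ = c log n` in general metrics. -/
noncomputable def generalFactor (α β : ℝ) : ℝ :=
  generalBound α β (weightScale α β) + 1 / Real.log 2

theorem generalFactor_pos (hα : 0 < α) (hβ : 0 < β) : 0 < generalFactor α β :=
  add_pos_of_nonneg_of_pos (generalBound_nonneg hα.le hβ.le (weightScale_pos α hβ).le)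
    (one_div_pos.mpr (Real.log_pos one_lt_two))

theorem achieves_of_metricSpace (hα : 0 < α) (hβ : 0 < β) (hν : 0 ≤ ν) (hn : 2 ≤ n) (hk : 1 ≤ k)
    (hsr : ∀ v, s v ≠ r v) (hπ : ∀ u v, π u < π v → dist (s v) (r v) ≤ dist (s u) (r u))
    (b : Fin n → Finset (Fin k) → ℕ) :
    Achieves α β ν (weightScale α β) (generalFactor α β * Real.log n) s r π b
      (32 * generalFactor α β / Real.log 2 * (Real.sqrt k * Real.log n ^ 2)) := by
  have hτ := weightScale_pos α hβ
  have hlog2 : 0 < Real.log 2 := Real.log_pos one_lt_two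
  have hlogn : Real.log 2 ≤ Real.log n := Real.log_le_log two_pos (by exact_mod_cast hn)
  have hone : 1 ≤ 1 / Real.log 2 * Real.log n := by
    rwa [one_div_mul_eq_div, one_le_div hlog2]
  have hbound : 0 ≤ generalBound α β (weightScale α β) * Real.log n :=
    mul_nonneg (generalBound_nonneg hα.le hβ.le hτ.le) (hlog2.le.trans hlogn)
  have hsplit : generalFactor α β * Real.log n =
      generalBound α β (weightScale α β) * Real.log n + 1 / Real.log 2 * Real.log n := add_mul _ _ _
  have hind := (inductiveIndependenceLE_general hα hβ hν hτ hn hsr hπ).mono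
    (show _ ≤ generalFactor α β * Real.log n by linarith)
  convert achieves_of_inductiveIndependenceLE hα hβ hν hn hk (by linarith) hsr hind b using 1
  ring

end Achieves

end SpectrumAuction

theorem mainTheorem4 (α β : ℝ) (hα : 0 < α) (hβ : 0 < β) :
    ∃ τ : ℝ, 0 < τ ∧
      -- fading metrics
      (∀ C δ : ℝ, δ < α → ∃ ρ K : ℝ, 0 < ρ ∧ 0 < K ∧
        ∀ (X : Type*) [MetricSpace X], SpectrumAuction.HasPacking X C δ →
        ∀ (n k : ℕ), 2 ≤ n → 1 ≤ k → ∀ (ν : ℝ), 0 ≤ ν →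
        ∀ (s r : Fin n → X), (∀ v, s v ≠ r v) →
        ∀ (π : Fin n ≃ Fin n),
          (∀ u v, π u < π v → dist (s v) (r v) ≤ dist (s u) (r u)) →
        ∀ (b : Fin n → Finset (Fin k) → ℕ),
          SpectrumAuction.Achieves α β ν τ ρ s r π b (K * (Real.sqrt k * Real.log n))) ∧
      -- general metrics
      (∃ c K : ℝ, 0 < c ∧ 0 < K ∧
        ∀ (X : Type*) [MetricSpace X],
        ∀ (n k : ℕ), 2 ≤ n → 1 ≤ k → ∀ (ν : ℝ), 0 ≤ ν →
        ∀ (s r : Fin n → X), (∀ v, s v ≠ r v) →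
        ∀ (π : Fin n ≃ Fin n),
          (∀ u v, π u < π v → dist (s v) (r v) ≤ dist (s u) (r u)) →
        ∀ (b : Fin n → Finset (Fin k) → ℕ),
          SpectrumAuction.Achieves α β ν τ (c * Real.log n) s r π b
            (K * (Real.sqrt k * Real.log n ^ 2))) := by
  open SpectrumAuction in
  have hc : 0 < generalFactor α β := generalFactor_pos hα hβ
  refine ⟨weightScale α β, weightScale_pos α hβ, fun C δ hδ => ?_, ?_⟩
  · refine ⟨max 1 (fadingBound α β (weightScale α β) C δ), _, by positivity, ?_,
      fun X _ hX n k hn hk ν hν s r hsr π hπ b =>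
        achieves_of_hasPacking hX hα hβ hδ hν hn hk hsr hπ b⟩
    positivity
  · refine ⟨generalFactor α β, _, hc, ?_, fun X _ n k hn hk ν hν s r hsr π hπ b =>
      achieves_of_metricSpace hα hβ hν hn hk hsr hπ b⟩
    positivity
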